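/- Let $G=(G_i)_{i\in\mathbb N}$ be the coordinate process on the Wiener space $(\Omega,\mathfrak W,\mathbb P)=(\mathbb R,\mathcal B(\mathbb R),\gamma)^{\otimes\mathbb N}$, where $\gamma=\mathcal N(0,1)$, so that the $G_i$ are independent standard Gaussian variables. Let $H_k$ be the monic Hermite polynomial of degree $k$ for $\gamma$ ($H_0=1$, $H_{k+1}(x)=xH_k(x)-H_k'(x)$). For $m\ge 0$ let $\mathcal W_m\subset L^2(\mathbb P)$ be the $m$-th Wiener chaos, i.e. the closed linear span of the finite products $\prod_i H_{k_i}(G_i)$ with $\sum_i k_i=m$; let $\mathsf J_m$ be the orthogonal projection of $L^2(\mathbb P)$ onto $\mathcal W_m$, and let $\mathcal W_{\le d}=\bigoplus_{m\le d}\mathcal W_m$. On $\bigcup_d\mathcal W_{\le d}$ define $$\mathsf L F=\sum_{m}(-m)\,\mathsf J_mF,\qquad \Gamma[F,X]=\tfrac12\bigl(\mathsf L(FX)-F\,\mathsf LX-X\,\mathsf LF\bigr),$$ and, for $q\ge 0$, the directional influence of degree $q$ $$\rho_q(F)=\sup\bigl\{\|\Gamma[F,X]\|_{L^2(\mathbb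 P)}: X\in\mathcal W_q,\ \mathbb E[X^2]=1\bigr\}.$$ Theorem. Let $p\ge 1$ and let $(F_n)$ be a sequence in $\mathcal W_p$ with $\mathbb E[F_n^2]\to 1$ (for instance $\mathbb E[F_n^2]=1$ for all $n$). Then $F_nX\in\mathcal W_{\le p+q}$ for every $q\ge 0$ and $X\in\mathcal W_q$, and $H_k(F_n)\in\mathcal W_{\le kp}$ for every $k\ge 0$, so that all the quantities below are well defined, and the following are equivalent. 1. $(F_n)$ is asymptotically Gaussian: $F_n$ converges in law to $\mathcal N(0,1)$. 2. $\operatorname{Var}\Gamma[F_n,F_n]\to 0$. 3. For every $k\ge 2$, $(\mathsf L+kp)H_k(F_n)\to 0$ in $L^2(\mathbb P)$. 4. For every $k\ge 2$ and every $q\ne kp$, $\mathsf J_qH_k(F_n)\to 0$ in $L^2(\mathbb P)$. 5. $\rho_{p-1}(F_n)\to 0$. 6. $\rho_{\lfloor p/2\rfloor}(F_n)\to 0$. -/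

import Mathlib

open MeasureTheory ProbabilityTheory Filter Topology
open scoped ENNReal

noncomputable section

namespace Wiener

/-- The Wiener space is the product space `ℝ^ℕ`; the `i`-th coordinate is the variable `G_i`. -/
abbrev Space : Type := ℕ → ℝ

/-- The Wiener measure: the countable product of standard Gaussian distributions. -/
abbrev gaussianProd : Measure Space := Measure.infinitePi (fun _ : ℕ => gaussianReal 0 1)

/-- The Hilbert space of square integrable real random variables on the Wiener space. -/
abbrev L2 : Type := Lp ℝ 2 gaussianProd

/-- The `k`-th (probabilists', monic) Hermite polynomial, as a function on the reals. -/
def hermiteFun (k : ℕ) (x : ℝ) : ℝ := Polynomial.aeval x (Polynomial.hermite k)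

/-- The product of the variables `H_{k_i}(G_i)`, for a finitely supported multi-index `k`. -/
def hermiteProd (k : ℕ →₀ ℕ) (ω : Space) : ℝ := k.prod fun i m => hermiteFun m (ω i)

/-- The Wiener chaos of degree `p`: the closed linear span in `L2` of the Hermite products of
total degree `p`. -/
def chaos (p : ℕ) : Submodule ℝ L2 :=
  (Submodule.span ℝ
    {Y : L2 | ∃ k : ℕ →₀ ℕ, k.degree = p ∧ Y =ᵐ[gaussianProd] hermiteProd k}).topologicalClosure

instance (p : ℕ) : CompleteSpace (chaos p) :=
  inferInstanceAs (CompleteSpace (Submodule.topologicalClosure _))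

/-- The sum of the Wiener chaoses of degree at most `d`. -/
def chaosLE (d : ℕ) : Submodule ℝ L2 := ⨆ m ∈ Finset.range (d + 1), chaos m

/-- The orthogonal projection of `L2` onto the Wiener chaos of degree `m`. -/
def J (m : ℕ) : L2 →L[ℝ] L2 := (chaos m).starProjection

/-- The Ornstein-Uhlenbeck generator, which multiplies the component in the chaos of degree `m`
by `-m`. For a variable in finitely many chaoses the sum has finitely many nonzero terms. -/
def L (F : L2) : L2 := ∑' m : ℕ, (-(m : ℝ)) • J m F

open Classical in
/-- The class in `L2` of a square integrable function (and `0` for any other function). -/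
def toL2 (f : Space → ℝ) : L2 := if h : MemLp f 2 gaussianProd then h.toLp f else 0

/-- The carré du champ operator `Γ[F, X] = (L(FX) - F L(X) - X L(F)) / 2`. -/
def Gam (F X : L2) : Space → ℝ := fun ω =>
  (1 / 2) * (L (toL2 fun ω' => F ω' * X ω') ω - F ω * L X ω - X ω * L F ω)

/-- The directional influence of degree `q`: the supremum of the `L²` norm of `Γ[F, X]` over all
`X` of unit variance in the chaos of degree `q`. -/
def influence (q : ℕ) (F : L2) : ℝ≥0∞ :=
  ⨆ (X : L2) (_ : X ∈ chaos q) (_ : ‖X‖ = 1), eLpNorm (Gam F X) 2 gaussianProd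

/-- The variable `H_k(F)`. -/
def hermiteOf (k : ℕ) (F : L2) : Space → ℝ := fun ω => hermiteFun k (F ω)

end Wiener

end

/-!
The theorem follows from exact spectral identities for polynomials in finitely many Gaussian
coordinates, which pass to the Wiener chaoses by density.

On polynomials in the coordinates of a finite set, the Ornstein–Uhlenbeck operator is the
differential operator `ouOp = ∑ (∂ᵢ² - Xᵢ ∂ᵢ)`, its carré du champ is `gam P Q = ⟨∇P, ∇Q⟩`, and
products of Hermite polynomials of total degree `p` are eigenvectors with eigenvalue `-p`. Gaussian
integration by parts (`expect_X_mul`) makes the operator symmetric and yields the orthogonality of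
the chaoses and the Poincaré inequality (`poincare`). The Poincaré inequality for `P²`, with an
induction on the degree, yields a form of hypercontractivity (`exists_expect_pow_four_le`): fourth
moments are bounded by squares of second moments with a constant that depends on the degree only.
Hence multiplication is continuous from two finite sums of chaoses to `L²` (`norm_mulL2_le`), and
identities and inequalities for polynomials extend to the Wiener chaoses.

Let `P` be in the chaos of degree `p`. The implications rest on the following facts.

* If `R m` are the chaotic components of `P²`, then `2 Γ(P,P) = ∑ (2p - m) R m`, and
  `0 ≤ 2p - m ≤ 2p`. Together with `3 E[P² Γ(P,P)] = p E[P⁴]` this bounds the variance of `Γ(P,P)`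
  by the fourth cumulant (`variance_gamL2_le`). For an asymptotically Gaussian sequence the
  fourth cumulant tends to zero, as hypercontractivity makes the fourth powers uniformly integrable
  (`eventually_norm_mulL2_lt`).
* By the chain rule and the Hermite differential equation `(L + kp) H_k(P) = H_k''(P) (Γ(P,P) - p)`
  (`ouOp_aeval_hermite`), so that condition 2 implies condition 3. On the chaos of degree `q ≠ kp`
  the operator `L + kp` is multiplication by `kp - q ≠ 0`, so that condition 3 implies condition 4.
* If the components of degree `0` of `H_k(F n)` tend to zero, then the expectations of all
  Hermite polynomials, hence all moments, converge to those of the Gaussian distribution, which is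
  determined by its moments (`tendsto_charFun_of_moments`). So condition 4 implies condition 1.
* For `X` in the chaos of degree `q < p`, the symmetry of `L` gives
  `(p - q) E[P² X²] = E[Γ(P,P) X²] - E[P² Γ(X,X)]`. An induction on `q` over the derivatives of `X`
  shows that `E[P² X²]` is close to `E[X²]` when `Γ(P,P)` is close to `p`
  (`exists_abs_expect_sq_mul_sq_sub_le`). As `2 E[P X Γ(P,X)] = p E[P² X²] - E[Γ(P,P) X²]`
  dominates the second moment of `Γ(P,X)` up to a constant, the influences of all degrees less than
  `p` are then small (`exists_expect_gam_sq_le_gamDev`).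
* Conversely, influences increase with the degree, as test variables can be multiplied by a fresh
  Gaussian coordinate. As `E[Γ(P,X) Y] = s E[P X Y]` when `X` and `Y` have degrees `s` and `p - s`,
  and one of `s`, `p - s` is at most `⌊p/2⌋`, a small influence of degree `q ≥ ⌊p/2⌋` makes all the
  trilinear forms `E[P X Y]` small (`InfluenceSqLE.expect_mul_mul_sq_le`), hence also the matrices
  `E[∂_J P ∂_K P]` with `1 ≤ |J| = |K| < p`. These are the expectations which remain when the
  Poincaré inequality is iterated on `Γ(P,P)`, so the variance of `Γ(P,P)` is small
  (`InfluenceSqLE.expect_gam_sub_sq_le`).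
-/

noncomputable section

namespace Wiener

/-! ### Expectation of polynomials in the Gaussian coordinates -/

/-- Polynomials in the coordinates `G_i`. Each of them involves finitely many coordinates only. -/
abbrev Poly : Type := MvPolynomial ℕ ℝ

lemma measurable_eval (P : Poly) : Measurable fun ω : Space => MvPolynomial.eval ω P := by
  induction P using MvPolynomial.induction_on with
  | C a => simp
  | add p q hp hq => simp only [map_add]; exact hp.add hq
  | mul_X p i hp =>
    simp only [map_mul, MvPolynomial.eval_X]
    exact hp.mul (measurable_pi_apply i)

lemma memLp_eval (P : Poly) (n : ℕ) :
    MemLp (fun ω : Space => MvPolynomial.eval ω P) ((2 : ℝ≥0∞) ^ n) gaussianProd := by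
  have hX : ∀ (i : ℕ) (r : ℝ≥0∞), r ≠ ∞ → MemLp (fun ω : Space => ω i) r gaussianProd := by
    intro i r hr
    have h := measurePreserving_eval_infinitePi (fun _ : ℕ => gaussianReal 0 1) i
    exact (memLp_id_gaussianReal' (μ := 0) (v := 1) r hr).comp_measurePreserving h
  induction P using MvPolynomial.induction_on generalizing n with
  | C a => simpa using memLp_const a
  | add p q hp hq => simp only [map_add]; exact (hp n).add (hq n)
  | mul_X p i hp =>
    have : ENNReal.HolderTriple ((2 : ℝ≥0∞) ^ (n + 1)) ((2 : ℝ≥0∞) ^ (n + 1)) ((2 : ℝ≥0∞) ^ n) := by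
      constructor
      rw [pow_succ, ENNReal.mul_inv (by simp) (by simp), ← mul_add, ENNReal.inv_two_add_inv_two,
        mul_one]
    simp only [map_mul, MvPolynomial.eval_X]
    exact (hX i ((2 : ℝ≥0∞) ^ (n + 1)) (by simp)).mul' (hp (n + 1))

lemma integrable_eval (P : Poly) :
    Integrable (fun ω : Space => MvPolynomial.eval ω P) gaussianProd :=
  memLp_one_iff_integrable.1 (by simpa using memLp_eval P 0)

/-- The expectation of a polynomial in the Gaussian coordinates. -/
def expect : Poly →ₗ[ℝ] ℝ where
  toFun P := ∫ ω, MvPolynomial.eval ω P ∂gaussianProd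
  map_add' P Q := by
    simpa using integral_add (integrable_eval P) (integrable_eval Q)
  map_smul' c P := by
    simp [MvPolynomial.smul_eval, integral_const_mul]

lemma expect_eq_integral (P : Poly) :
    expect P = ∫ ω, MvPolynomial.eval ω P ∂gaussianProd := rfl

@[simp]
lemma expect_C (c : ℝ) : expect (MvPolynomial.C c) = c := by
  simp [expect_eq_integral]

@[simp]
lemma expect_one : expect 1 = 1 := by
  rw [← MvPolynomial.C_1, expect_C]

lemma expect_C_mul (c : ℝ) (P : Poly) : expect (MvPolynomial.C c * P) = c * expect P := by
  rw [MvPolynomial.C_mul', map_smul, smul_eq_mul]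

lemma expect_sq_nonneg (P : Poly) : 0 ≤ expect (P ^ 2) := by
  rw [expect_eq_integral]
  exact integral_nonneg fun ω => by simp only [map_pow]; positivity

/-- The Cauchy–Schwarz inequality. -/
lemma expect_mul_sq_le (P Q : Poly) :
    expect (P * Q) ^ 2 ≤ expect (P ^ 2) * expect (Q ^ 2) := by
  -- The quadratic polynomial `t ↦ E[(P + tQ)²]` is nonnegative.
  have key : ∀ t : ℝ, 0 ≤ expect (Q ^ 2) * (t * t) + 2 * expect (P * Q) * t + expect (P ^ 2) := by
    intro t
    have h := expect_sq_nonneg (P + MvPolynomial.C t * Q)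
    have e : (P + MvPolynomial.C t * Q) ^ 2 = P ^ 2 + MvPolynomial.C (2 * t) * (P * Q)
        + MvPolynomial.C (t * t) * Q ^ 2 := by
      simp only [map_mul, map_ofNat]; ring
    rw [e, map_add, map_add, expect_C_mul, expect_C_mul] at h
    linarith
  have h := discrim_le_zero key
  rw [discrim] at h
  nlinarith

lemma expect_mul_le_sqrt (P Q : Poly) :
    |expect (P * Q)| ≤ √(expect (P ^ 2)) * √(expect (Q ^ 2)) := by
  rw [← Real.sqrt_mul (expect_sq_nonneg P)]
  exact Real.abs_le_sqrt (expect_mul_sq_le P Q)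

/-! ### Gaussian integration by parts -/

lemma integrable_pow_gaussianReal (k : ℕ) : Integrable (fun x : ℝ => x ^ k) (gaussianReal 0 1) := by
  have h := (memLp_id_gaussianReal (μ := 0) (v := 1) (k : NNReal)).integrable_norm_pow'
  rw [← integrable_norm_iff (by fun_prop)]
  simpa using h

/-- The moment recursion of the standard Gaussian distribution. For `k = 0` the truncated exponent
`k - 1` on the right is harmless, as the integral is multiplied by zero. -/
lemma integral_pow_succ_gaussianReal (k : ℕ) :
    ∫ x, x ^ (k + 1) ∂gaussianReal 0 1 = k * ∫ x, x ^ (k - 1) ∂gaussianReal 0 1 := by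
  have hd : ∀ x : ℝ, HasDerivAt (gaussianPDFReal 0 1) (-x * gaussianPDFReal 0 1 x) x := by
    intro x
    have h1 : HasDerivAt (fun y : ℝ => -(y - 0) ^ 2 / (2 * ((1 : NNReal) : ℝ))) (-x) x := by
      have := (((hasDerivAt_id x).sub_const 0).pow 2).neg.div_const (2 * ((1 : NNReal) : ℝ))
      refine this.congr_deriv ?_
      simp; ring
    have h2 := (h1.exp).const_mul ((√(2 * Real.pi * ((1 : NNReal) : ℝ)))⁻¹)
    have e : gaussianPDFReal 0 1 = fun y : ℝ => (√(2 * Real.pi * ((1 : NNReal) : ℝ)))⁻¹ *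
        Real.exp (-(y - 0) ^ 2 / (2 * ((1 : NNReal) : ℝ))) := gaussianPDFReal_def 0 1
    rw [e]
    refine h2.congr_deriv ?_
    ring
  have hint : ∀ m : ℕ, Integrable (fun x : ℝ => x ^ m * gaussianPDFReal 0 1 x) := by
    intro m
    have h := integrable_pow_gaussianReal m
    rw [gaussianReal_of_var_ne_zero _ (by norm_num), integrable_withDensity_iff_integrable_smul'
      (measurable_gaussianPDF 0 1) (ae_of_all _ fun x => gaussianPDF_lt_top)] at h
    refine h.congr (ae_of_all _ fun x => ?_)
    simp only [toReal_gaussianPDF, smul_eq_mul]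
    ring
  have h := integral_mul_deriv_eq_deriv_mul_of_integrable (u := fun x : ℝ => x ^ k)
    (u' := fun x => k * x ^ (k - 1)) (v := gaussianPDFReal 0 1)
    (v' := fun x => -x * gaussianPDFReal 0 1 x) (fun x _ => hasDerivAt_pow k x) (fun x _ => hd x)
    (by
      refine (hint (k + 1)).neg.congr (ae_of_all _ fun x => ?_)
      simp; ring)
    (by
      refine ((hint (k - 1)).const_mul k).congr (ae_of_all _ fun x => ?_)
      simp; ring)
    (hint k)
  rw [integral_gaussianReal_eq_integral_smul (by norm_num),
    integral_gaussianReal_eq_integral_smul (by norm_num), ← integral_const_mul]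
  simp only [smul_eq_mul]
  -- `x φ(x)` is minus the derivative of the density `φ`.
  have e1 : ∫ x, gaussianPDFReal 0 1 x * x ^ (k + 1) =
      -∫ x : ℝ, x ^ k * (-x * gaussianPDFReal 0 1 x) := by
    rw [← integral_neg]; congr 1; ext x; ring
  rw [e1, h, neg_neg]
  congr 1; ext x; ring

lemma expect_monomial (S : Finset ℕ) (k : ℕ →₀ ℕ) (hk : k.support ⊆ S) :
    expect (MvPolynomial.monomial k 1) = ∏ i ∈ S, ∫ x, x ^ k i ∂gaussianReal 0 1 := by
  have e : ∀ ω : Space, MvPolynomial.eval ω (MvPolynomial.monomial k 1) =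
      (fun y : S → ℝ => ∏ i, y i ^ k i) (S.restrict ω) := by
    intro ω
    rw [MvPolynomial.eval_monomial, one_mul, Finsupp.prod_of_support_subset k hk _ (by simp)]
    simp only [Finset.restrict]
    exact (Finset.prod_coe_sort S fun i => ω i ^ k i).symm
  rw [expect_eq_integral, integral_congr_ae (ae_of_all _ e)]
  refine (integral_restrict_infinitePi (X := fun _ : ℕ => ℝ) (s := S)
    (μ := fun _ : ℕ => gaussianReal 0 1) (f := fun y : S → ℝ => ∏ i, y i ^ k i)
    (Continuous.aestronglyMeasurable (by fun_prop))).trans ?_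
  rw [integral_fintype_prod_eq_prod (f := fun (i : S) (x : ℝ) => x ^ k i)]
  exact Finset.prod_coe_sort S fun i => ∫ x, x ^ k i ∂gaussianReal 0 1

/-- Gaussian integration by parts. -/
lemma expect_X_mul (i : ℕ) (P : Poly) :
    expect (MvPolynomial.X i * P) = expect (MvPolynomial.pderiv i P) := by
  induction P using MvPolynomial.induction_on' with
  | add p q hp hq => simp only [mul_add, map_add, hp, hq]
  | monomial k a =>
    have h1 : MvPolynomial.X i * MvPolynomial.monomial k a =
        a • MvPolynomial.monomial (k + Finsupp.single i 1) (1 : ℝ) := by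
      rw [MvPolynomial.X, MvPolynomial.monomial_mul, MvPolynomial.smul_monomial, add_comm]; simp
    have h2 : MvPolynomial.pderiv i (MvPolynomial.monomial k a) =
        (a * k i) • MvPolynomial.monomial (k - Finsupp.single i 1) (1 : ℝ) := by
      rw [MvPolynomial.pderiv_monomial, MvPolynomial.smul_monomial]; simp
    rw [h1, h2, map_smul, map_smul]
    have hi : i ∈ insert i k.support := Finset.mem_insert_self _ _
    have hne : ∀ j ∈ (insert i k.support).erase i, Finsupp.single i 1 j = 0 := by
      intro j hj
      rw [Finsupp.single_apply, if_neg (Finset.ne_of_mem_erase hj).symm]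
    rw [expect_monomial (insert i k.support) _ ?_, expect_monomial (insert i k.support) _ ?_,
      ← Finset.mul_prod_erase _ _ hi, ← Finset.mul_prod_erase _ _ hi]
    · have e1 : ∀ j ∈ (insert i k.support).erase i,
          ∫ x, x ^ ((k + Finsupp.single i 1 : ℕ →₀ ℕ) j) ∂gaussianReal 0 1 =
            ∫ x, x ^ ((k - Finsupp.single i 1 : ℕ →₀ ℕ) j) ∂gaussianReal 0 1 := by
        intro j hj
        rw [Finsupp.add_apply, Finsupp.tsub_apply, hne j hj, add_zero, tsub_zero]
      rw [Finset.prod_congr rfl e1]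
      simp only [Finsupp.add_apply, Finsupp.single_eq_same, Finsupp.tsub_apply, smul_eq_mul]
      rw [integral_pow_succ_gaussianReal]
      ring
    · exact (Finsupp.support_tsub).trans (Finset.subset_insert _ _)
    · refine Finsupp.support_add.trans (Finset.union_subset (Finset.subset_insert _ _) ?_)
      exact Finsupp.support_single_subset.trans (by simp)

/-! ### The Ornstein–Uhlenbeck operator on polynomials -/

open MvPolynomial in
/-- The Ornstein–Uhlenbeck operator `∑ i, (∂ᵢ² - Xᵢ ∂ᵢ)` in the coordinates of a finite set `S`. -/
def ouOp (S : Finset ℕ) : Poly →ₗ[ℝ] Poly where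
  toFun P := ∑ i ∈ S, (pderiv i (pderiv i P) - X i * pderiv i P)
  map_add' P Q := by
    rw [← Finset.sum_add_distrib]
    exact Finset.sum_congr rfl fun i _ => by simp only [map_add]; ring
  map_smul' c P := by
    rw [RingHom.id_apply, Finset.smul_sum]
    exact Finset.sum_congr rfl fun i _ => by
      simp only [Derivation.map_smul, smul_sub, mul_smul_comm]

/-- The carré du champ `⟨∇P, ∇Q⟩` of polynomials in the coordinates of a finite set `S`. -/
def gam (S : Finset ℕ) (P Q : Poly) : Poly :=
  ∑ i ∈ S, MvPolynomial.pderiv i P * MvPolynomial.pderiv i Q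

section
open MvPolynomial

variable (S : Finset ℕ)

lemma ouOp_apply (P : Poly) :
    ouOp S P = ∑ i ∈ S, (pderiv i (pderiv i P) - X i * pderiv i P) := rfl

lemma gam_comm (P Q : Poly) : gam S P Q = gam S Q P :=
  Finset.sum_congr rfl fun _ _ => mul_comm _ _

lemma gam_mul_right (P Q R : Poly) : gam S P (Q * R) = Q * gam S P R + R * gam S P Q := by
  simp only [gam, pderiv_mul, Finset.mul_sum, ← Finset.sum_add_distrib]
  exact Finset.sum_congr rfl fun i _ => by ring

lemma gam_mul_left (P Q R : Poly) : gam S (Q * R) P = Q * gam S R P + R * gam S Q P := by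
  rw [gam_comm, gam_mul_right, gam_comm S P R, gam_comm S P Q]

lemma ouOp_mul (P Q : Poly) :
    ouOp S (P * Q) = P * ouOp S Q + Q * ouOp S P + 2 * gam S P Q := by
  simp only [ouOp_apply, gam, Finset.mul_sum, ← Finset.sum_add_distrib]
  refine Finset.sum_congr rfl fun i _ => ?_
  simp only [pderiv_mul, map_add]
  ring

/-- The Dirichlet form of the Ornstein–Uhlenbeck operator is the expected carré du champ. -/
lemma expect_mul_ouOp (P Q : Poly) : expect (P * ouOp S Q) = -expect (gam S P Q) := by
  simp only [ouOp_apply, gam, Finset.mul_sum, map_sum, ← Finset.sum_neg_distrib]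
  refine Finset.sum_congr rfl fun i _ => ?_
  have h := expect_X_mul i (P * pderiv i Q)
  rw [pderiv_mul, map_add] at h
  rw [mul_sub, map_sub, show P * (X i * pderiv i Q) = X i * (P * pderiv i Q) by ring, h]
  ring

/-- The Ornstein–Uhlenbeck operator is symmetric. -/
lemma expect_mul_ouOp_comm (P Q : Poly) : expect (P * ouOp S Q) = expect (Q * ouOp S P) := by
  rw [expect_mul_ouOp, expect_mul_ouOp, gam_comm]

end

/-! ### Hermite polynomials and the polynomial chaoses -/

section
open MvPolynomial

lemma derivative_hermite_succ (n : ℕ) :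
    Polynomial.derivative (Polynomial.hermite (n + 1)) = (n + 1) * Polynomial.hermite n := by
  induction n with
  | zero => simp
  | succ n ih =>
    rw [Polynomial.hermite_succ (n + 1), Polynomial.derivative_sub, Polynomial.derivative_mul, ih,
      Polynomial.derivative_X, Polynomial.derivative_mul]
    have : Polynomial.derivative ((n : Polynomial ℤ) + 1) = 0 := by
      simp
    rw [this, Polynomial.hermite_succ n]
    push_cast
    ring

lemma derivative_hermite (n : ℕ) :
    Polynomial.derivative (Polynomial.hermite n) = n * Polynomial.hermite (n - 1) := by
  cases n with
  | zero => simp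
  | succ n => simpa using derivative_hermite_succ n

/-- The product of the Hermite polynomials `H_{k_i}(X_i)`, as a polynomial. -/
def herm (k : ℕ →₀ ℕ) : Poly :=
  k.prod fun i m => Polynomial.aeval (X i : Poly) (Polynomial.hermite m)

lemma herm_eq_mul_erase (k : ℕ →₀ ℕ) (i : ℕ) :
    herm k = Polynomial.aeval (X i : Poly) (Polynomial.hermite (k i)) * herm (k.erase i) :=
  (Finsupp.mul_prod_erase' k i _ fun i => by simp).symm

lemma eval_herm (k : ℕ →₀ ℕ) (ω : Space) : eval ω (herm k) = hermiteProd k ω := by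
  simp only [herm, hermiteProd, Finsupp.prod, map_prod, hermiteFun]
  refine Finset.prod_congr rfl fun i _ => ?_
  have h := Polynomial.aeval_algHom_apply ((MvPolynomial.aeval ω : Poly →ₐ[ℝ] ℝ).restrictScalars ℤ)
    (X i) (Polynomial.hermite (k i))
  simp only [AlgHom.restrictScalars_apply, aeval_X] at h
  rw [h, MvPolynomial.aeval_eq_eval]

lemma pderiv_aeval_hermite (i : ℕ) (P : Poly) (n : ℕ) :
    pderiv i (Polynomial.aeval P (Polynomial.hermite n)) =
      n * Polynomial.aeval P (Polynomial.hermite (n - 1)) * pderiv i P := by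
  have h := Derivation.map_aeval ((pderiv i : Derivation ℝ Poly Poly).restrictScalars ℤ)
    (Polynomial.hermite n) P
  rw [derivative_hermite, map_mul, map_natCast, smul_eq_mul] at h
  exact h

lemma pderiv_herm_of_notMem {k : ℕ →₀ ℕ} {i : ℕ} (hi : i ∉ k.support) :
    pderiv i (herm k) = 0 := by
  refine Finset.prod_induction _ (fun P : Poly => pderiv i P = 0) ?_ (by simp) ?_
  · intro P Q hP hQ; rw [pderiv_mul, hP, hQ]; ring
  · intro j hj
    rw [pderiv_aeval_hermite, pderiv_X_of_ne (by rintro rfl; exact hi hj), mul_zero]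

lemma erase_tsub_single (k : ℕ →₀ ℕ) (i m : ℕ) :
    (k - Finsupp.single i m).erase i = k.erase i := by
  ext j
  by_cases h : j = i
  · subst h; simp
  · simp [Finsupp.erase_ne h, Ne.symm h]

lemma erase_add_single (k : ℕ →₀ ℕ) (i m : ℕ) :
    (k + Finsupp.single i m).erase i = k.erase i := by
  ext j
  by_cases h : j = i
  · subst h; simp
  · simp [Finsupp.erase_ne h]

lemma pderiv_herm (k : ℕ →₀ ℕ) (i : ℕ) :
    pderiv i (herm k) = (k i : ℝ) • herm (k - Finsupp.single i 1) := by
  rw [herm_eq_mul_erase k i, herm_eq_mul_erase (k - Finsupp.single i 1) i, erase_tsub_single,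
    pderiv_mul, pderiv_herm_of_notMem (k := k.erase i) (by simp), pderiv_aeval_hermite,
    pderiv_X_self, MvPolynomial.smul_eq_C_mul]
  simp
  ring

/-- The three-term recursion of Hermite polynomials. -/
lemma X_mul_herm (k : ℕ →₀ ℕ) (i : ℕ) :
    X i * herm k = herm (k + Finsupp.single i 1) + pderiv i (herm k) := by
  rw [pderiv_herm, herm_eq_mul_erase k i, herm_eq_mul_erase (k - Finsupp.single i 1) i,
    herm_eq_mul_erase (k + Finsupp.single i 1) i, erase_tsub_single, erase_add_single]
  simp only [Finsupp.add_apply, Finsupp.single_eq_same, Polynomial.hermite_succ, map_sub, map_mul,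
    Polynomial.aeval_X, derivative_hermite, map_natCast, Finsupp.tsub_apply,
    MvPolynomial.smul_eq_C_mul]
  ring

lemma ouOp_herm {S : Finset ℕ} {k : ℕ →₀ ℕ} (hk : k.support ⊆ S) :
    ouOp S (herm k) = -(k.degree : ℝ) • herm k := by
  have h : ∀ i ∈ S, pderiv i (pderiv i (herm k)) - X i * pderiv i (herm k) =
      -(k i : ℝ) • herm k := by
    intro i _
    rw [pderiv_herm k i, Derivation.map_smul, mul_smul_comm, X_mul_herm]
    by_cases h0 : k i = 0
    · simp [h0]
    · have : k - Finsupp.single i 1 + Finsupp.single i 1 = k :=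
        tsub_add_cancel_of_le (Finsupp.single_le_iff.2 (Nat.one_le_iff_ne_zero.2 h0))
      rw [this, smul_add, neg_smul]
      abel
  rw [ouOp_apply, Finset.sum_congr rfl h, ← Finset.sum_smul, Finset.sum_neg_distrib]
  congr 2
  rw [Finsupp.degree_apply, Nat.cast_sum]
  exact (Finset.sum_subset hk fun i _ hi => by simpa using hi).symm

/-- The polynomials of the `p`-th chaos in the coordinates of a finite set `S`. -/
def pchaos (S : Finset ℕ) (p : ℕ) : Submodule ℝ Poly :=
  Submodule.span ℝ {P | ∃ k : ℕ →₀ ℕ, k.degree = p ∧ k.support ⊆ S ∧ P = herm k}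

lemma herm_mem_pchaos {S : Finset ℕ} {k : ℕ →₀ ℕ} (hk : k.support ⊆ S) :
    herm k ∈ pchaos S k.degree :=
  Submodule.subset_span ⟨k, rfl, hk, rfl⟩

lemma pchaos_mono {S T : Finset ℕ} (h : S ⊆ T) (p : ℕ) : pchaos S p ≤ pchaos T p :=
  Submodule.span_mono fun _ ⟨k, hk, hs, e⟩ => ⟨k, hk, hs.trans h, e⟩

lemma ouOp_pchaos {S : Finset ℕ} {p : ℕ} {P : Poly} (hP : P ∈ pchaos S p) :
    ouOp S P = -(p : ℝ) • P := by
  induction hP using Submodule.span_induction with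
  | mem P h =>
    obtain ⟨k, rfl, hs, rfl⟩ := h
    exact ouOp_herm hs
  | zero => simp
  | add P Q _ _ hP hQ => rw [map_add, hP, hQ, smul_add]
  | smul c P _ hP => rw [map_smul, hP, smul_comm]

lemma one_mem_pchaos (S : Finset ℕ) : (1 : Poly) ∈ pchaos S 0 := by
  have h := herm_mem_pchaos (S := S) (k := 0) (by simp)
  simpa [herm] using h

/-- The chaos of degree `0` consists of the constants. -/
lemma exists_eq_C_of_mem_pchaos_zero {S : Finset ℕ} {P : Poly} (hP : P ∈ pchaos S 0) :
    ∃ c : ℝ, P = C c := by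
  induction hP using Submodule.span_induction with
  | mem P h =>
    obtain ⟨k, hk, hs, rfl⟩ := h
    rw [Finsupp.degree_eq_zero_iff] at hk
    exact ⟨1, by simp [hk, herm]⟩
  | zero => exact ⟨0, by simp⟩
  | add P Q _ _ hP hQ =>
    obtain ⟨a, rfl⟩ := hP
    obtain ⟨b, rfl⟩ := hQ
    exact ⟨a + b, by simp⟩
  | smul c P _ hP =>
    obtain ⟨a, rfl⟩ := hP
    exact ⟨c * a, by simp [MvPolynomial.smul_eq_C_mul]⟩

lemma pderiv_mem_pchaos {S : Finset ℕ} {p : ℕ} {P : Poly} (hP : P ∈ pchaos S p) (i : ℕ) :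
    pderiv i P ∈ pchaos S (p - 1) := by
  induction hP using Submodule.span_induction with
  | mem P h =>
    obtain ⟨k, rfl, hs, rfl⟩ := h
    rw [pderiv_herm]
    by_cases h0 : k i = 0
    · simp [h0]
    · refine Submodule.smul_mem _ _ ?_
      have e : k - Finsupp.single i 1 + Finsupp.single i 1 = k :=
        tsub_add_cancel_of_le (Finsupp.single_le_iff.2 (Nat.one_le_iff_ne_zero.2 h0))
      have hd : (k - Finsupp.single i 1).degree = k.degree - 1 := by
        conv_rhs => rw [← e]
        simp
      rw [← hd]
      exact herm_mem_pchaos (Finsupp.support_tsub.trans hs)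
  | zero => simp
  | add P Q _ _ hP hQ => rw [map_add]; exact Submodule.add_mem _ hP hQ
  | smul c P _ hP => rw [Derivation.map_smul]; exact Submodule.smul_mem _ _ hP

lemma pderiv_eq_zero_of_mem_pchaos {S : Finset ℕ} {p : ℕ} {P : Poly} (hP : P ∈ pchaos S p) {i : ℕ}
    (hi : i ∉ S) : pderiv i P = 0 := by
  induction hP using Submodule.span_induction with
  | mem P h =>
    obtain ⟨k, rfl, hs, rfl⟩ := h
    exact pderiv_herm_of_notMem fun h => hi (hs h)
  | zero => simp
  | add P Q _ _ hP hQ => rw [map_add, hP, hQ, add_zero]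
  | smul c P _ hP => rw [Derivation.map_smul, hP, smul_zero]

lemma pderiv_pchaos_zero {S : Finset ℕ} {P : Poly} (hP : P ∈ pchaos S 0) (i : ℕ) :
    pderiv i P = 0 := by
  obtain ⟨c, rfl⟩ := exists_eq_C_of_mem_pchaos_zero hP
  simp

/-- On the chaos of degree `p`, integration by parts reads `E⟨∇Q, ∇P⟩ = p E[QP]`. -/
lemma expect_gam_of_mem {S : Finset ℕ} {p : ℕ} {P : Poly} (hP : P ∈ pchaos S p) (Q : Poly) :
    expect (gam S Q P) = p * expect (Q * P) := by
  have h := expect_mul_ouOp S Q P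
  rw [ouOp_pchaos hP, mul_smul_comm, map_smul, smul_eq_mul] at h
  linarith

/-- Polynomial chaoses of different degrees are orthogonal. -/
lemma expect_mul_eq_zero {S : Finset ℕ} {p q : ℕ} (hpq : p ≠ q) {P Q : Poly}
    (hP : P ∈ pchaos S p) (hQ : Q ∈ pchaos S q) : expect (P * Q) = 0 := by
  have h1 := expect_gam_of_mem hP Q
  have h2 := expect_gam_of_mem hQ P
  rw [gam_comm, h2, mul_comm Q P] at h1
  have h3 : ((q : ℝ) - p) * expect (P * Q) = 0 := by linarith
  rcases mul_eq_zero.1 h3 with h | h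
  · exact absurd (by exact_mod_cast (sub_eq_zero.1 h).symm) hpq
  · exact h

lemma expect_eq_zero {S : Finset ℕ} {p : ℕ} (hp : p ≠ 0) {P : Poly} (hP : P ∈ pchaos S p) :
    expect P = 0 := by
  simpa using expect_mul_eq_zero hp hP (one_mem_pchaos S)

end

section
open MvPolynomial

/-! ### Sums of polynomial chaoses -/

/-- The sum of the polynomial chaoses of degree at most `d` in the coordinates of `S`. -/
def pchaosLE (S : Finset ℕ) (d : ℕ) : Submodule ℝ Poly :=
  ⨆ m ∈ Finset.range (d + 1), pchaos S m

variable {S : Finset ℕ}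

lemma pchaos_le_pchaosLE {m d : ℕ} (h : m ≤ d) : pchaos S m ≤ pchaosLE S d :=
  le_biSup (pchaos S) (Finset.mem_range.2 (Nat.lt_succ_of_le h))

lemma pchaosLE_mono {a b : ℕ} (h : a ≤ b) : pchaosLE S a ≤ pchaosLE S b :=
  iSup₂_le fun _ hm => pchaos_le_pchaosLE ((Nat.lt_succ_iff.1 (Finset.mem_range.1 hm)).trans h)

lemma exists_chaos_decomp {d : ℕ} {P : Poly} (hP : P ∈ pchaosLE S d) :
    ∃ R : ℕ → Poly, (∀ m, R m ∈ pchaos S m) ∧ P = ∑ m ∈ Finset.range (d + 1), R m := by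
  obtain ⟨R, hR⟩ := (Submodule.mem_iSup_finset_iff_exists_sum _ _).1 hP
  exact ⟨fun m => R m, fun m => (R m).2, hR.symm⟩

lemma pderiv_mem_pchaosLE {d : ℕ} {P : Poly} (hP : P ∈ pchaosLE S d) (i : ℕ) :
    pderiv i P ∈ pchaosLE S (d - 1) := by
  obtain ⟨R, hR, rfl⟩ := exists_chaos_decomp hP
  rw [map_sum]
  refine Submodule.sum_mem _ fun m hm => pchaos_le_pchaosLE ?_ (pderiv_mem_pchaos (hR m) i)
  have := Finset.mem_range.1 hm
  omega

lemma X_mul_mem_pchaosLE {d i : ℕ} (hi : i ∈ S) {P : Poly} (hP : P ∈ pchaosLE S d) :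
    X i * P ∈ pchaosLE S (d + 1) := by
  have key : ∀ m, ∀ Q ∈ pchaos S m, X i * Q ∈ pchaosLE S (m + 1) := by
    intro m Q hQ
    induction hQ using Submodule.span_induction with
    | mem P h =>
      obtain ⟨k, rfl, hs, rfl⟩ := h
      rw [X_mul_herm]
      refine Submodule.add_mem _ (pchaos_le_pchaosLE le_rfl ?_)
        (pchaos_le_pchaosLE (by omega) (pderiv_mem_pchaos (herm_mem_pchaos hs) i))
      have h := herm_mem_pchaos (S := S) (k := k + Finsupp.single i 1)
        (Finsupp.support_add.trans (Finset.union_subset hs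
          (Finsupp.support_single_subset.trans (by simpa using hi))))
      simpa using h
    | zero => simp
    | add P Q _ _ hP hQ => rw [mul_add]; exact Submodule.add_mem _ hP hQ
    | smul c P _ hP => rw [mul_smul_comm]; exact Submodule.smul_mem _ _ hP
  obtain ⟨R, hR, rfl⟩ := exists_chaos_decomp hP
  rw [Finset.mul_sum]
  refine Submodule.sum_mem _ fun m hm => pchaosLE_mono ?_ (key m _ (hR m))
  have := Finset.mem_range.1 hm
  omega

lemma herm_mul_mem_pchaosLE (n : ℕ) : ∀ (k : ℕ →₀ ℕ), k.support ⊆ S → k.degree = n →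
    ∀ (b : ℕ) (Q : Poly), Q ∈ pchaosLE S b → herm k * Q ∈ pchaosLE S (n + b) := by
  induction n using Nat.strong_induction_on with
  | _ n ih =>
  intro k hk hn b Q hQ
  by_cases h0 : k = 0
  · subst h0
    simp only [herm, Finsupp.prod_zero_index, one_mul]
    exact pchaosLE_mono (by omega) hQ
  · obtain ⟨i, hi⟩ := Finsupp.support_nonempty_iff.2 h0
    have hki : k i ≠ 0 := Finsupp.mem_support_iff.1 hi
    set l := k - Finsupp.single i 1 with hl
    have e : l + Finsupp.single i 1 = k :=
      tsub_add_cancel_of_le (Finsupp.single_le_iff.2 (Nat.one_le_iff_ne_zero.2 hki))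
    have hls : l.support ⊆ S := Finsupp.support_tsub.trans hk
    have hd : l.degree + 1 = n := by rw [← hn, ← e]; simp
    have e2 : herm k = X i * herm l - (l i : ℝ) • herm (l - Finsupp.single i 1) := by
      rw [X_mul_herm, pderiv_herm, e]; abel
    rw [e2, sub_mul, mul_assoc, smul_mul_assoc]
    refine Submodule.sub_mem _ ?_ ?_
    · have h1 := X_mul_mem_pchaosLE (hk hi) (ih _ (by omega) l hls rfl b Q hQ)
      exact pchaosLE_mono (by omega) h1
    · by_cases hli : l i = 0
      · simp [hli]
      · refine Submodule.smul_mem _ _ ?_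
        have e3 : l - Finsupp.single i 1 + Finsupp.single i 1 = l :=
          tsub_add_cancel_of_le (Finsupp.single_le_iff.2 (Nat.one_le_iff_ne_zero.2 hli))
        have hd2 : (l - Finsupp.single i 1).degree + 1 = l.degree := by
          conv_rhs => rw [← e3]
          simp
        exact pchaosLE_mono (by omega)
          (ih _ (by omega) _ (Finsupp.support_tsub.trans hls) rfl b Q hQ)

lemma mul_mem_pchaosLE {a b : ℕ} {P Q : Poly} (hP : P ∈ pchaosLE S a) (hQ : Q ∈ pchaosLE S b) :
    P * Q ∈ pchaosLE S (a + b) := by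
  obtain ⟨R, hR, rfl⟩ := exists_chaos_decomp hP
  rw [Finset.sum_mul]
  refine Submodule.sum_mem _ fun m hm => ?_
  have hm' := Finset.mem_range.1 hm
  have key : ∀ T ∈ pchaos S m, T * Q ∈ pchaosLE S (m + b) := by
    intro T hT
    induction hT using Submodule.span_induction with
    | mem P h =>
      obtain ⟨k, hk, hs, rfl⟩ := h
      exact herm_mul_mem_pchaosLE m k hs hk b Q hQ
    | zero => simp
    | add P Q _ _ hP hQ => rw [add_mul]; exact Submodule.add_mem _ hP hQ
    | smul c P _ hP => rw [smul_mul_assoc]; exact Submodule.smul_mem _ _ hP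
  exact pchaosLE_mono (by omega) (key _ (hR m))

lemma sq_mem_pchaosLE {a : ℕ} {P : Poly} (hP : P ∈ pchaosLE S a) : P ^ 2 ∈ pchaosLE S (2 * a) := by
  rw [sq, two_mul]; exact mul_mem_pchaosLE hP hP

lemma gam_mem_pchaosLE {a b : ℕ} {P Q : Poly} (hP : P ∈ pchaosLE S a) (hQ : Q ∈ pchaosLE S b) :
    gam S P Q ∈ pchaosLE S (a + b) :=
  Submodule.sum_mem _ fun i _ => pchaosLE_mono (by omega)
    (mul_mem_pchaosLE (pderiv_mem_pchaosLE hP i) (pderiv_mem_pchaosLE hQ i))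

/-! ### Spectral inequalities -/

lemma expect_sum_mul_sum {R T : ℕ → Poly} (hR : ∀ m, R m ∈ pchaos S m)
    (hT : ∀ m, T m ∈ pchaos S m) (s : Finset ℕ) :
    expect ((∑ m ∈ s, R m) * ∑ m ∈ s, T m) = ∑ m ∈ s, expect (R m * T m) := by
  rw [Finset.sum_mul_sum, map_sum]
  refine Finset.sum_congr rfl fun m hm => ?_
  rw [map_sum, Finset.sum_eq_single m (fun j _ hj => expect_mul_eq_zero hj.symm (hR m) (hT j))
    (fun h => absurd hm h)]

lemma ouOp_sum {R : ℕ → Poly} (hR : ∀ m, R m ∈ pchaos S m) (s : Finset ℕ) :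
    ouOp S (∑ m ∈ s, R m) = ∑ m ∈ s, (-(m : ℝ)) • R m := by
  rw [map_sum]
  exact Finset.sum_congr rfl fun m _ => ouOp_pchaos (hR m)

lemma expect_gam_sum {R : ℕ → Poly} (hR : ∀ m, R m ∈ pchaos S m) (s : Finset ℕ) :
    expect (gam S (∑ m ∈ s, R m) (∑ m ∈ s, R m)) = ∑ m ∈ s, (m : ℝ) * expect (R m ^ 2) := by
  have h := expect_mul_ouOp S (∑ m ∈ s, R m) (∑ m ∈ s, R m)
  rw [ouOp_sum hR, expect_sum_mul_sum hR (fun m => Submodule.smul_mem _ _ (hR m))] at h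
  rw [← neg_eq_iff_eq_neg] at h
  rw [← h, ← Finset.sum_neg_distrib]
  refine Finset.sum_congr rfl fun m _ => ?_
  rw [mul_smul_comm, map_smul, smul_eq_mul, sq]; ring

lemma expect_sum_sq {R : ℕ → Poly} (hR : ∀ m, R m ∈ pchaos S m) (s : Finset ℕ) :
    expect ((∑ m ∈ s, R m) ^ 2) = ∑ m ∈ s, expect (R m ^ 2) := by
  rw [sq, expect_sum_mul_sum hR hR]
  exact Finset.sum_congr rfl fun m _ => by rw [sq]

lemma expect_sum_range {R : ℕ → Poly} (hR : ∀ m, R m ∈ pchaos S m) (d : ℕ) :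
    expect (∑ m ∈ Finset.range (d + 1), R m) = expect (R 0) := by
  rw [map_sum, Finset.sum_eq_single 0 (fun m _ hm => expect_eq_zero hm (hR m)) (by simp)]

lemma expect_sq_of_mem_zero {P : Poly} (hP : P ∈ pchaos S 0) :
    expect (P ^ 2) = expect P ^ 2 := by
  obtain ⟨c, rfl⟩ := exists_eq_C_of_mem_pchaos_zero hP
  rw [← C_pow, expect_C, expect_C]

/-- The Poincaré inequality. -/
lemma poincare {d : ℕ} {P : Poly} (hP : P ∈ pchaosLE S d) :
    expect (P ^ 2) ≤ expect P ^ 2 + expect (gam S P P) := by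
  obtain ⟨R, hR, rfl⟩ := exists_chaos_decomp hP
  -- The component of degree `0` is the mean, and all others have an eigenvalue at least `1`.
  rw [expect_sum_sq hR, expect_sum_range hR, expect_gam_sum hR, ← expect_sq_of_mem_zero (hR 0),
    Finset.sum_range_succ', Finset.sum_range_succ']
  have : ∀ m ∈ Finset.range d, expect (R (m + 1) ^ 2) ≤
      ((m + 1 : ℕ) : ℝ) * expect (R (m + 1) ^ 2) := by
    intro m _
    have h := expect_sq_nonneg (R (m + 1))
    push_cast
    nlinarith [Nat.cast_nonneg (α := ℝ) m]
  have := Finset.sum_le_sum this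
  simp only [Nat.cast_zero, zero_mul, add_zero]
  linarith

lemma expect_gam_self_le {d : ℕ} {P : Poly} (hP : P ∈ pchaosLE S d) :
    expect (gam S P P) ≤ d * expect (P ^ 2) := by
  obtain ⟨R, hR, rfl⟩ := exists_chaos_decomp hP
  rw [expect_sum_sq hR, expect_gam_sum hR, Finset.mul_sum]
  refine Finset.sum_le_sum fun m hm => ?_
  have : (m : ℝ) ≤ d := by exact_mod_cast Nat.lt_succ_iff.1 (Finset.mem_range.1 hm)
  exact mul_le_mul_of_nonneg_right this (expect_sq_nonneg _)

lemma expect_gam_self (P : Poly) :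
    expect (gam S P P) = ∑ i ∈ S, expect (pderiv i P ^ 2) := by
  rw [gam, map_sum]
  exact Finset.sum_congr rfl fun i _ => by rw [sq]

/-! ### Hypercontractivity -/

/-- Fourth moments of polynomials of bounded degree are controlled by second moments, uniformly in
the number of variables. The Poincaré inequality applied to `P²` reduces the bound for `P` to the
bound for the partial derivatives of `P`, which have a smaller degree. -/
lemma exists_expect_pow_four_le (d : ℕ) : ∃ C : ℝ, 0 ≤ C ∧ ∀ (S : Finset ℕ) (P : Poly),
    P ∈ pchaosLE S d → expect (P ^ 4) ≤ C * expect (P ^ 2) ^ 2 := by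
  induction d with
  | zero =>
    refine ⟨1, zero_le_one, fun S P hP => ?_⟩
    obtain ⟨R, hR, rfl⟩ := exists_chaos_decomp hP
    obtain ⟨c, hc⟩ := exists_eq_C_of_mem_pchaos_zero (hR 0)
    simp only [zero_add, Finset.range_one, Finset.sum_singleton, hc, ← C_pow, expect_C]
    exact le_of_eq (by ring)
  | succ d ih =>
    obtain ⟨C, hC, ih⟩ := ih
    set K : ℝ := 4 * √C * (d + 1 : ℕ) with hK
    have hK0 : 0 ≤ K := by positivity
    refine ⟨(1 + K) ^ 2, by positivity, fun S P hP => ?_⟩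
    set y := √(expect (P ^ 4)) with hy
    have hP4 : 0 ≤ expect (P ^ 4) := by
      have := expect_sq_nonneg (P ^ 2); rwa [← pow_mul] at this
    have hy2 : y ^ 2 = expect (P ^ 4) := Real.sq_sqrt hP4
    have hy0 : 0 ≤ y := Real.sqrt_nonneg _
    set e := expect (P ^ 2) with he
    have he0 : 0 ≤ e := expect_sq_nonneg P
    have h1 := poincare (sq_mem_pchaosLE hP)
    rw [← pow_mul, ← hy2] at h1
    have h2 : expect (gam S (P ^ 2) (P ^ 2)) ≤ K * y * e := by
      have e1 : gam S (P ^ 2) (P ^ 2) =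
          ∑ i ∈ S, MvPolynomial.C (4 : ℝ) * (P ^ 2 * pderiv i P ^ 2) := by
        refine Finset.sum_congr rfl fun i _ => ?_
        rw [sq P, pderiv_mul, map_ofNat]; ring
      rw [e1, map_sum]
      have h3 : ∀ i ∈ S, expect (MvPolynomial.C (4 : ℝ) * (P ^ 2 * pderiv i P ^ 2)) ≤
          4 * √C * y * expect (pderiv i P ^ 2) := by
        intro i _
        have hD := ih S _ (pderiv_mem_pchaosLE hP i)
        have h4 := (le_abs_self _).trans (expect_mul_le_sqrt (P ^ 2) (pderiv i P ^ 2))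
        rw [← pow_mul, ← pow_mul] at h4
        have h5 : √(expect (pderiv i P ^ (2 * 2))) ≤ √C * expect (pderiv i P ^ 2) := by
          refine (Real.sqrt_le_sqrt hD).trans ?_
          rw [Real.sqrt_mul hC, Real.sqrt_sq (expect_sq_nonneg _)]
        rw [expect_C_mul]
        have h6 := mul_le_mul_of_nonneg_left h5 hy0
        simp only [hy] at h6 ⊢
        calc 4 * expect (P ^ 2 * pderiv i P ^ 2) ≤ 4 * _ :=
              mul_le_mul_of_nonneg_left h4 (by norm_num)
          _ ≤ 4 * _ := mul_le_mul_of_nonneg_left h6 (by norm_num)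
          _ = _ := by ring
      refine (Finset.sum_le_sum h3).trans ?_
      rw [← Finset.mul_sum, ← expect_gam_self]
      have h7 := expect_gam_self_le hP
      calc _ ≤ 4 * √C * y * (((d + 1 : ℕ) : ℝ) * e) := mul_le_mul_of_nonneg_left h7 (by positivity)
        _ = K * y * e := by rw [hK]; ring
    have h8 : y ^ 2 ≤ e ^ 2 + K * y * e := h1.trans (by linarith)
    -- `y² ≤ e² + K y e` forces `y ≤ (1 + K) e`.
    have h9 : y ≤ (1 + K) * e := by
      by_contra hcon
      push Not at hcon
      have hye : e ≤ y := by nlinarith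
      have hypos : 0 < y := lt_of_le_of_lt (by positivity) hcon
      nlinarith [mul_le_mul_of_nonneg_right hye he0, mul_lt_mul_of_pos_right hcon hypos]
    rw [← hy2]
    calc y ^ 2 ≤ ((1 + K) * e) ^ 2 := pow_le_pow_left₀ hy0 h9 2
      _ = _ := by ring

/-- A constant `C` with `E[P⁴] ≤ C E[P²]²` for polynomials of degree at most `d`. -/
def hyperConst (d : ℕ) : ℝ := (exists_expect_pow_four_le d).choose

lemma hyperConst_nonneg (d : ℕ) : 0 ≤ hyperConst d := (exists_expect_pow_four_le d).choose_spec.1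

lemma expect_pow_four_le {d : ℕ} {P : Poly} (hP : P ∈ pchaosLE S d) :
    expect (P ^ 4) ≤ hyperConst d * expect (P ^ 2) ^ 2 :=
  (exists_expect_pow_four_le d).choose_spec.2 S P hP

lemma sqrt_expect_pow_four_le {d : ℕ} {P : Poly} (hP : P ∈ pchaosLE S d) :
    √(expect (P ^ 4)) ≤ √(hyperConst d) * expect (P ^ 2) := by
  refine (Real.sqrt_le_sqrt (expect_pow_four_le hP)).trans ?_
  rw [Real.sqrt_mul (hyperConst_nonneg d), Real.sqrt_sq (expect_sq_nonneg _)]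

lemma expect_sq_mul_sq_le {a b : ℕ} {P Q : Poly} (hP : P ∈ pchaosLE S a) (hQ : Q ∈ pchaosLE S b) :
    expect ((P * Q) ^ 2) ≤
      √(hyperConst a) * √(hyperConst b) * (expect (P ^ 2) * expect (Q ^ 2)) := by
  have h := (le_abs_self _).trans (expect_mul_le_sqrt (P ^ 2) (Q ^ 2))
  rw [← mul_pow, ← pow_mul, ← pow_mul] at h
  refine h.trans ((mul_le_mul (sqrt_expect_pow_four_le hP) (sqrt_expect_pow_four_le hQ)
    (Real.sqrt_nonneg _) (mul_nonneg (Real.sqrt_nonneg _) (expect_sq_nonneg _))).trans ?_)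
  exact le_of_eq (by ring)

end

section
open MvPolynomial

variable {S : Finset ℕ}

/-! ### The carré du champ of two chaotic polynomials -/

lemma two_mul_gam {p q : ℕ} {P Q : Poly} (hP : P ∈ pchaos S p) (hQ : Q ∈ pchaos S q) :
    2 * gam S P Q = ouOp S (P * Q) + ((p : ℝ) + q) • (P * Q) := by
  rw [ouOp_mul, ouOp_pchaos hP, ouOp_pchaos hQ]
  simp only [MvPolynomial.smul_eq_C_mul, map_neg, map_add]
  ring

lemma two_mul_gam_eq_sum {p q : ℕ} {P Q : Poly} (hP : P ∈ pchaos S p) (hQ : Q ∈ pchaos S q)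
    {R : ℕ → Poly} (hR : ∀ m, R m ∈ pchaos S m) {s : Finset ℕ} (h : P * Q = ∑ m ∈ s, R m) :
    2 * gam S P Q = ∑ m ∈ s, ((p : ℝ) + q - m) • R m := by
  rw [two_mul_gam hP hQ, h, ouOp_sum hR, Finset.smul_sum, ← Finset.sum_add_distrib]
  refine Finset.sum_congr rfl fun m _ => ?_
  rw [← add_smul]; congr 1; ring

lemma expect_four_mul (P : Poly) : expect ((2 * P) ^ 2) = 4 * expect (P ^ 2) := by
  rw [show (2 * P) ^ 2 = MvPolynomial.C (4 : ℝ) * P ^ 2 by rw [map_ofNat]; ring, expect_C_mul]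

lemma expect_two_mul (P : Poly) : expect (2 * P) = 2 * expect P := by
  rw [show 2 * P = MvPolynomial.C (2 : ℝ) * P by rw [map_ofNat], expect_C_mul]

lemma expect_smul_sq (c : ℝ) (P : Poly) : expect ((c • P) ^ 2) = c ^ 2 * expect (P ^ 2) := by
  rw [smul_pow, map_smul, smul_eq_mul]

/-- Since `2Γ(P,Q) = ∑ (p+q-m) R_m` where `R_m` are the chaotic components of `PQ`, and
`0 ≤ p+q-m ≤ p+q`, the second moment of `Γ(P,Q)` is controlled by its correlation with `PQ`. -/
lemma expect_gam_sq_le {p q : ℕ} {P Q : Poly} (hP : P ∈ pchaos S p) (hQ : Q ∈ pchaos S q) :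
    expect (gam S P Q ^ 2) ≤ (p + q) / 2 * expect (P * Q * gam S P Q) := by
  obtain ⟨R, hR, h⟩ := exists_chaos_decomp
    (mul_mem_pchaosLE (pchaos_le_pchaosLE le_rfl hP) (pchaos_le_pchaosLE le_rfl hQ))
  have h2 := two_mul_gam_eq_sum hP hQ hR h
  have hR' : ∀ m : ℕ, ((p : ℝ) + q - m) • R m ∈ pchaos S m := fun m => Submodule.smul_mem _ _ (hR m)
  have e1 := expect_sum_sq hR' (Finset.range (p + q + 1))
  rw [← h2, expect_four_mul] at e1
  have e2 := expect_sum_mul_sum hR hR' (Finset.range (p + q + 1))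
  rw [← h2, ← h, show P * Q * (2 * gam S P Q) = 2 * (P * Q * gam S P Q) by ring,
    expect_two_mul] at e2
  have h3 : 4 * expect (gam S P Q ^ 2) ≤ (p + q) * (2 * expect (P * Q * gam S P Q)) := by
    rw [e1, e2, Finset.mul_sum]
    refine Finset.sum_le_sum fun m hm => ?_
    have hm' : (m : ℝ) ≤ p + q := by exact_mod_cast Nat.lt_succ_iff.1 (Finset.mem_range.1 hm)
    rw [expect_smul_sq, mul_smul_comm, map_smul, smul_eq_mul, ← sq, ← mul_assoc]
    refine mul_le_mul_of_nonneg_right ?_ (expect_sq_nonneg _)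
    nlinarith [Nat.cast_nonneg (α := ℝ) m]
  linarith

lemma expect_gam_self_of_mem {p : ℕ} {P : Poly} (hP : P ∈ pchaos S p) :
    expect (gam S P P) = p * expect (P ^ 2) := by
  rw [expect_gam_of_mem hP, sq]

lemma expect_sub_C_sq (P : Poly) (c : ℝ) :
    expect ((P - MvPolynomial.C c) ^ 2) = expect (P ^ 2) - 2 * c * expect P + c ^ 2 := by
  rw [show (P - MvPolynomial.C c) ^ 2 =
      P ^ 2 - MvPolynomial.C (2 * c) * P + MvPolynomial.C (c ^ 2) by
    simp only [map_mul, map_pow, map_ofNat]; ring, map_add, map_sub, expect_C_mul, expect_C]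

/-! ### The fourth cumulant controls the carré du champ -/

/-- The quantitative fourth moment bound on the variance of `Γ(P,P)`. -/
lemma expect_gam_sub_sq_le {p : ℕ} {P : Poly} (hP : P ∈ pchaos S p) :
    expect ((gam S P P - MvPolynomial.C (p * expect (P ^ 2))) ^ 2) ≤
      p ^ 2 / 3 * (expect (P ^ 4) - 3 * expect (P ^ 2) ^ 2) := by
  obtain ⟨R, hR, h⟩ := exists_chaos_decomp
    (mul_mem_pchaosLE (pchaos_le_pchaosLE le_rfl hP) (pchaos_le_pchaosLE le_rfl hP))
  have h2 := two_mul_gam_eq_sum hP hP hR h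
  have hR' : ∀ m : ℕ, ((p : ℝ) + p - m) • R m ∈ pchaos S m := fun m => Submodule.smul_mem _ _ (hR m)
  have e1 := expect_sum_sq hR' (Finset.range (p + p + 1))
  rw [← h2, expect_four_mul] at e1
  have e2 := expect_sum_mul_sum hR hR' (Finset.range (p + p + 1))
  rw [← h2, ← h, show P * P * (2 * gam S P P) = 2 * (P ^ 2 * gam S P P) by ring,
    expect_two_mul] at e2
  have e3 : expect (P * P) = expect (R 0) := by rw [h, expect_sum_range hR]
  -- Integration by parts for `P³` and `P`, with `∇P³ = 3P²∇P`.
  have e4 : 3 * expect (P ^ 2 * gam S P P) = p * expect (P ^ 4) := by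
    have h4 := expect_gam_of_mem hP (P ^ 3)
    have : gam S (P ^ 3) P = MvPolynomial.C (3 : ℝ) * (P ^ 2 * gam S P P) := by
      rw [show P ^ 3 = P * (P * P) by ring, gam_mul_left, gam_mul_left, map_ofNat]; ring
    rw [this, expect_C_mul, ← pow_succ] at h4
    exact h4
  -- The mean is removed as the term `m = 0`; in the others, `(2p - m)² ≤ 2p (2p - m)`.
  have h3 : 4 * expect (gam S P P ^ 2) - (2 * p) ^ 2 * expect (P ^ 2) ^ 2 ≤
      (2 * p) * (2 * expect (P ^ 2 * gam S P P) - 2 * p * expect (P ^ 2) ^ 2) := by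
    have e5 : expect (P ^ 2) ^ 2 = expect (R 0 ^ 2) := by
      rw [expect_sq_of_mem_zero (hR 0), ← e3, sq P]
    rw [e1, e2, e5, Finset.sum_range_succ', Finset.sum_range_succ']
    have : ∀ m ∈ Finset.range (p + p),
        expect ((((p : ℝ) + p - (m + 1 : ℕ)) • R (m + 1)) ^ 2) ≤
          (2 * p) * expect (R (m + 1) * ((p : ℝ) + p - (m + 1 : ℕ)) • R (m + 1)) := by
      intro m hm
      have hm' : ((m + 1 : ℕ) : ℝ) ≤ p + p := by exact_mod_cast Finset.mem_range.1 hm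
      rw [expect_smul_sq, mul_smul_comm, map_smul, smul_eq_mul, ← sq, ← mul_assoc]
      refine mul_le_mul_of_nonneg_right ?_ (expect_sq_nonneg _)
      nlinarith [Nat.cast_nonneg (α := ℝ) (m + 1)]
    have := Finset.sum_le_sum this
    rw [← Finset.mul_sum] at this
    rw [expect_smul_sq, mul_smul_comm, map_smul, smul_eq_mul, ← sq]
    simp only [Nat.cast_zero, sub_zero]
    linarith
  rw [expect_sub_C_sq, expect_gam_self_of_mem hP]
  nlinarith

/-! ### Hermite polynomials of a chaotic polynomial -/

lemma aeval_hermite_succ_succ (P : Poly) (j : ℕ) :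
    Polynomial.aeval P (Polynomial.hermite (j + 2)) =
      P * Polynomial.aeval P (Polynomial.hermite (j + 1)) -
        ((j : Poly) + 1) * Polynomial.aeval P (Polynomial.hermite j) := by
  rw [Polynomial.hermite_succ (j + 1), derivative_hermite_succ]
  simp

lemma aeval_hermite_mem {p : ℕ} {P : Poly} (hP : P ∈ pchaos S p) (k : ℕ) :
    Polynomial.aeval P (Polynomial.hermite k) ∈ pchaosLE S (k * p) := by
  induction k using Nat.twoStepInduction with
  | zero => simpa using pchaos_le_pchaosLE le_rfl (one_mem_pchaos S)
  | one => simpa [Polynomial.hermite_one] using pchaos_le_pchaosLE le_rfl hP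
  | more j h0 h1 =>
    rw [aeval_hermite_succ_succ]
    refine Submodule.sub_mem _ ?_ ?_
    · exact pchaosLE_mono (by ring_nf; omega)
        (mul_mem_pchaosLE (pchaos_le_pchaosLE le_rfl hP) h1)
    · have : ((j : Poly) + 1) = MvPolynomial.C ((j : ℝ) + 1) := by simp
      rw [this, MvPolynomial.C_mul']
      exact Submodule.smul_mem _ _ (pchaosLE_mono (Nat.mul_le_mul_right _ (by omega)) h0)

lemma expect_sub_sq_le (P Q : Poly) :
    expect ((P - Q) ^ 2) ≤ 2 * expect (P ^ 2) + 2 * expect (Q ^ 2) := by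
  have h := expect_sq_nonneg (P + Q)
  have e : (P - Q) ^ 2 + (P + Q) ^ 2 =
      MvPolynomial.C (2 : ℝ) * P ^ 2 + MvPolynomial.C (2 : ℝ) * Q ^ 2 := by
    simp only [map_ofNat]; ring
  have e2 := congrArg expect e
  rw [map_add, map_add, expect_C_mul, expect_C_mul] at e2
  linarith

lemma exists_expect_hermite_sq_le (p k : ℕ) : ∃ B : ℝ, 0 ≤ B ∧ ∀ (S : Finset ℕ) (P : Poly),
    P ∈ pchaos S p → expect (P ^ 2) ≤ 2 →
      expect (Polynomial.aeval P (Polynomial.hermite k) ^ 2) ≤ B := by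
  induction k using Nat.twoStepInduction with
  | zero => exact ⟨1, zero_le_one, fun S P _ _ => by simp⟩
  | one => exact ⟨2, zero_le_two, fun S P _ h => by simpa [Polynomial.hermite_one] using h⟩
  | more j h0 h1 =>
    obtain ⟨B0, hB0, h0⟩ := h0
    obtain ⟨B1, hB1, h1⟩ := h1
    set K := √(hyperConst p) * √(hyperConst ((j + 1) * p)) with hK
    have hK0 : 0 ≤ K := by positivity
    refine ⟨2 * (K * (2 * B1)) + 2 * ((j + 1) ^ 2 * B0), by positivity, fun S P hP h => ?_⟩
    rw [aeval_hermite_succ_succ]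
    refine (expect_sub_sq_le _ _).trans ?_
    have e1 := expect_sq_mul_sq_le (pchaos_le_pchaosLE le_rfl hP) (aeval_hermite_mem hP (j + 1))
    have e2 : expect (((j : Poly) + 1) ^ 2 * Polynomial.aeval P (Polynomial.hermite j) ^ 2) =
        (j + 1) ^ 2 * expect (Polynomial.aeval P (Polynomial.hermite j) ^ 2) := by
      rw [← expect_C_mul]; simp
    rw [mul_pow ((j : Poly) + 1), e2]
    have e3 := mul_le_mul h (h1 S P hP h) (expect_sq_nonneg _) zero_le_two
    have e4 := mul_le_mul_of_nonneg_left e3 hK0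
    have e5 := mul_le_mul_of_nonneg_left (h0 S P hP h) (by positivity : 0 ≤ ((j : ℝ) + 1) ^ 2)
    linarith

/-- The Ornstein–Uhlenbeck operator nearly has `H_k(P)` as an eigenvector when `Γ(P,P)` is nearly
constant: this combines the chain rule and the Hermite differential equation. -/
lemma ouOp_aeval_hermite {p : ℕ} {P : Poly} (hP : P ∈ pchaos S p) (j : ℕ) :
    ouOp S (Polynomial.aeval P (Polynomial.hermite (j + 2))) +
        (((j + 2 : ℕ) : ℝ) * p) • Polynomial.aeval P (Polynomial.hermite (j + 2)) =
      (((j : ℝ) + 2) * (j + 1)) • (Polynomial.aeval P (Polynomial.hermite j) *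
        (gam S P P - MvPolynomial.C (p : ℝ))) := by
  have h : ouOp S (Polynomial.aeval P (Polynomial.hermite (j + 2))) =
      ((j : Poly) + 2) * (((j : Poly) + 1) * Polynomial.aeval P (Polynomial.hermite j) * gam S P P
        + Polynomial.aeval P (Polynomial.hermite (j + 1)) * ouOp S P) := by
    simp only [ouOp_apply, gam, Finset.mul_sum, ← Finset.sum_add_distrib]
    refine Finset.sum_congr rfl fun i _ => ?_
    have e1 : pderiv i (Polynomial.aeval P (Polynomial.hermite (j + 2))) =
        ((j : Poly) + 2) * Polynomial.aeval P (Polynomial.hermite (j + 1)) * pderiv i P := by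
      rw [pderiv_aeval_hermite]; simp
    have e2 : pderiv i (Polynomial.aeval P (Polynomial.hermite (j + 1))) =
        ((j : Poly) + 1) * Polynomial.aeval P (Polynomial.hermite j) * pderiv i P := by
      rw [pderiv_aeval_hermite]; simp
    have e3 : pderiv i ((j : Poly) + 2) = 0 := by
      rw [show ((j : Poly) + 2) = MvPolynomial.C ((j : ℝ) + 2) by simp [map_ofNat MvPolynomial.C],
        pderiv_C]
    rw [e1, pderiv_mul, pderiv_mul, e2, e3]
    ring
  rw [h, ouOp_pchaos hP, aeval_hermite_succ_succ]
  simp only [MvPolynomial.smul_eq_C_mul, map_mul, map_add, map_neg, map_natCast, map_ofNat, map_one,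
    Nat.cast_add, Nat.cast_ofNat]
  ring

lemma gam_sub_C_mem {p : ℕ} {P : Poly} (hP : P ∈ pchaos S p) (c : ℝ) :
    gam S P P - MvPolynomial.C c ∈ pchaosLE S (p + p) := by
  refine Submodule.sub_mem _ (gam_mem_pchaosLE (pchaos_le_pchaosLE le_rfl hP)
    (pchaos_le_pchaosLE le_rfl hP)) ?_
  have := Submodule.smul_mem _ c (pchaos_le_pchaosLE (Nat.zero_le (p + p)) (one_mem_pchaos S))
  rwa [MvPolynomial.smul_eq_C_mul, mul_one] at this

lemma exists_expect_ouOp_hermite_le (p k : ℕ) (hk : 2 ≤ k) : ∃ C : ℝ, 0 ≤ C ∧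
    ∀ (S : Finset ℕ) (P : Poly), P ∈ pchaos S p → expect (P ^ 2) ≤ 2 →
      expect ((ouOp S (Polynomial.aeval P (Polynomial.hermite k)) +
        ((k : ℝ) * p) • Polynomial.aeval P (Polynomial.hermite k)) ^ 2) ≤
      C * expect ((gam S P P - MvPolynomial.C (p : ℝ)) ^ 2) := by
  obtain ⟨j, rfl⟩ := Nat.exists_eq_add_of_le' hk
  obtain ⟨B, hB, h⟩ := exists_expect_hermite_sq_le p j
  set K := √(hyperConst (j * p)) * √(hyperConst (p + p)) with hK
  have hK0 : 0 ≤ K := by positivity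
  refine ⟨(((j : ℝ) + 2) * (j + 1)) ^ 2 * (K * B), by positivity, fun S P hP hP2 => ?_⟩
  rw [ouOp_aeval_hermite hP, expect_smul_sq, mul_assoc (_ ^ 2)]
  refine mul_le_mul_of_nonneg_left ?_ (by positivity)
  refine (expect_sq_mul_sq_le (aeval_hermite_mem hP j) (gam_sub_C_mem hP p)).trans ?_
  rw [← hK, mul_assoc K]
  exact mul_le_mul_of_nonneg_left
    (mul_le_mul_of_nonneg_right (h S P hP hP2) (expect_sq_nonneg _)) hK0

/-! ### Asymptotic independence of lower chaoses -/

/-- The identity `(p-q) E[P²X²] = E[Γ(P,P)X²] - E[P²Γ(X,X)]`. -/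
lemma expect_sq_mul_sq_eq {p q : ℕ} {P Q : Poly} (hP : P ∈ pchaos S p) (hQ : Q ∈ pchaos S q) :
    ((p : ℝ) - q) * expect (P ^ 2 * Q ^ 2) =
      expect (gam S P P * Q ^ 2) - expect (P ^ 2 * gam S Q Q) := by
  have h := expect_mul_ouOp_comm S (P ^ 2) (Q ^ 2)
  have e : ∀ {r : ℕ} {A B : Poly}, A ∈ pchaos S r → expect (B * ouOp S (A ^ 2)) =
      2 * expect (B * gam S A A) - 2 * r * expect (B * A ^ 2) := by
    intro r A B hA
    have : B * ouOp S (A ^ 2) =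
        MvPolynomial.C (2 : ℝ) * (B * gam S A A) - MvPolynomial.C (2 * (r : ℝ)) * (B * A ^ 2) := by
      rw [sq, ouOp_mul, ouOp_pchaos hA]
      simp only [MvPolynomial.smul_eq_C_mul, map_mul, map_neg, map_ofNat]
      ring
    rw [this, map_sub, expect_C_mul, expect_C_mul]
  rw [e hP, e hQ, mul_comm (Q ^ 2), mul_comm (Q ^ 2)] at h
  linarith

lemma expect_mul_mul_gam {p : ℕ} {P Q : Poly} (hP : P ∈ pchaos S p) :
    2 * expect (P * Q * gam S P Q) = p * expect (P ^ 2 * Q ^ 2) - expect (gam S P P * Q ^ 2) := by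
  have h := expect_mul_ouOp S (Q ^ 2) (P ^ 2)
  have e1 : Q ^ 2 * ouOp S (P ^ 2) =
      MvPolynomial.C (2 : ℝ) * (gam S P P * Q ^ 2) -
        MvPolynomial.C (2 * (p : ℝ)) * (P ^ 2 * Q ^ 2) := by
    rw [sq P, ouOp_mul, ouOp_pchaos hP]
    simp only [MvPolynomial.smul_eq_C_mul, map_mul, map_neg, map_ofNat]
    ring
  have e2 : gam S (Q ^ 2) (P ^ 2) = MvPolynomial.C (4 : ℝ) * (P * Q * gam S P Q) := by
    rw [sq, sq, gam_mul_left, gam_mul_right, gam_comm S Q P, map_ofNat]; ring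
  rw [e1, e2, map_sub, expect_C_mul, expect_C_mul, expect_C_mul] at h
  linarith

/-- The `L²` distance of `Γ(P,P)` from the constant `p`, which is its mean if `P` is in
the chaos of degree `p` and `E[P²] = 1`. -/
def gamDev (S : Finset ℕ) (p : ℕ) (P : Poly) : ℝ :=
  √(expect ((gam S P P - MvPolynomial.C (p : ℝ)) ^ 2))

lemma abs_expect_gam_mul_sq_sub_le {p q : ℕ} {P Q : Poly} (hQ : Q ∈ pchaos S q) :
    |expect (gam S P P * Q ^ 2) - p * expect (Q ^ 2)| ≤
      gamDev S p P * √(hyperConst q) * expect (Q ^ 2) := by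
  have h := expect_mul_le_sqrt (gam S P P - MvPolynomial.C (p : ℝ)) (Q ^ 2)
  rw [sub_mul, map_sub, expect_C_mul, ← pow_mul] at h
  refine h.trans ?_
  rw [mul_assoc]
  exact mul_le_mul_of_nonneg_left (sqrt_expect_pow_four_le (pchaos_le_pchaosLE le_rfl hQ))
    (Real.sqrt_nonneg _)

/-- The induction step for the asymptotic independence: a bound for the derivatives of `Q`, which
have a lower degree, is summed over the coordinates to handle `E[P² Γ(Q,Q)]`. -/
lemma abs_expect_sq_mul_sq_sub_le_of_pderiv {p q : ℕ} (hpq : q < p) {P Q : Poly}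
    (hP : P ∈ pchaos S p) (hQ : Q ∈ pchaos S q) {C : ℝ}
    (h : ∀ i, |expect (P ^ 2 * pderiv i Q ^ 2) - expect (pderiv i Q ^ 2)| ≤
      C * gamDev S p P * expect (pderiv i Q ^ 2)) :
    |expect (P ^ 2 * Q ^ 2) - expect (Q ^ 2)| ≤
      (√(hyperConst q) + C * q) * gamDev S p P * expect (Q ^ 2) := by
  have h1 := expect_sq_mul_sq_eq hP hQ
  have h2 := abs_expect_gam_mul_sq_sub_le (p := p) (P := P) hQ
  have h3 : |expect (P ^ 2 * gam S Q Q) - q * expect (Q ^ 2)| ≤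
      C * gamDev S p P * (q * expect (Q ^ 2)) := by
    rw [← expect_gam_self_of_mem hQ, expect_gam_self]
    have e : expect (P ^ 2 * gam S Q Q) = ∑ i ∈ S, expect (P ^ 2 * pderiv i Q ^ 2) := by
      rw [gam, Finset.mul_sum, map_sum]
      exact Finset.sum_congr rfl fun i _ => by rw [sq (pderiv i Q)]
    rw [e, ← Finset.sum_sub_distrib, Finset.mul_sum]
    exact (Finset.abs_sum_le_sum_abs _ _).trans (Finset.sum_le_sum fun i _ => h i)
  have h4 : ((p : ℝ) - q) * (expect (P ^ 2 * Q ^ 2) - expect (Q ^ 2)) =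
      (expect (gam S P P * Q ^ 2) - p * expect (Q ^ 2)) -
        (expect (P ^ 2 * gam S Q Q) - q * expect (Q ^ 2)) := by
    rw [mul_sub, h1]; ring
  have h5 : (1 : ℝ) ≤ (p : ℝ) - q := by
    have : ((q + 1 : ℕ) : ℝ) ≤ p := by exact_mod_cast hpq
    push_cast at this; linarith
  calc |expect (P ^ 2 * Q ^ 2) - expect (Q ^ 2)|
      ≤ |((p : ℝ) - q) * (expect (P ^ 2 * Q ^ 2) - expect (Q ^ 2))| := by
        rw [abs_mul]
        exact le_mul_of_one_le_left (abs_nonneg _) (h5.trans (le_abs_self _))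
    _ ≤ _ := by
        rw [h4]
        refine (abs_sub _ _).trans ((add_le_add h2 h3).trans (le_of_eq ?_))
        ring

/-- If `Γ(P,P)` is close to the constant `p`, then the square of `P` is nearly uncorrelated with
the square of every element of a strictly lower chaos. -/
lemma exists_abs_expect_sq_mul_sq_sub_le (p q : ℕ) (hpq : q < p) : ∃ C : ℝ, 0 ≤ C ∧
    ∀ (S : Finset ℕ) (P Q : Poly), P ∈ pchaos S p → Q ∈ pchaos S q →
      |expect (P ^ 2 * Q ^ 2) - expect (Q ^ 2)| ≤ C * gamDev S p P * expect (Q ^ 2) := by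
  induction q with
  | zero =>
    refine ⟨√(hyperConst 0) + 0 * (0 : ℕ), by positivity, fun S P Q hP hQ =>
      abs_expect_sq_mul_sq_sub_le_of_pderiv hpq hP hQ fun i => ?_⟩
    simp [pderiv_pchaos_zero hQ]
  | succ q ih =>
    obtain ⟨C, hC, h⟩ := ih (by omega)
    exact ⟨√(hyperConst (q + 1)) + C * (q + 1 : ℕ), by positivity, fun S P Q hP hQ =>
      abs_expect_sq_mul_sq_sub_le_of_pderiv hpq hP hQ fun i => h S P _ hP (pderiv_mem_pchaos hQ i)⟩

/-- The directional influences of degree less than `p` are controlled by the deviation of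
`Γ(P,P)` from `p`. -/
lemma exists_expect_gam_sq_le_gamDev (p q : ℕ) (hpq : q < p) : ∃ C : ℝ, 0 ≤ C ∧
    ∀ (S : Finset ℕ) (P Q : Poly), P ∈ pchaos S p → Q ∈ pchaos S q →
      expect (gam S P Q ^ 2) ≤ C * gamDev S p P * expect (Q ^ 2) := by
  obtain ⟨C, hC, h⟩ := exists_abs_expect_sq_mul_sq_sub_le p q hpq
  refine ⟨((p : ℝ) + q) / 4 * (p * C + √(hyperConst q)), by positivity, fun S P Q hP hQ => ?_⟩
  have h1 := expect_gam_sq_le hP hQ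
  have h2 := expect_mul_mul_gam (Q := Q) hP
  have h3 := (abs_le.1 (h S P Q hP hQ)).2
  have h4 := (abs_le.1 (abs_expect_gam_mul_sq_sub_le (p := p) (P := P) hQ)).1
  have h5 : 2 * expect (P * Q * gam S P Q) ≤
      (p * C + √(hyperConst q)) * gamDev S p P * expect (Q ^ 2) := by
    have := mul_le_mul_of_nonneg_left h3 (Nat.cast_nonneg (α := ℝ) p)
    linarith
  have h6 := mul_le_mul_of_nonneg_left h5 (by positivity : 0 ≤ ((p : ℝ) + q) / 4)
  linarith

end

section
open MvPolynomial

variable {S : Finset ℕ}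

/-! ### Iterated derivatives -/

lemma pderiv_pderiv_comm (i j : ℕ) (P : Poly) :
    pderiv i (pderiv j P) = pderiv j (pderiv i P) := by
  induction P using MvPolynomial.induction_on with
  | C a => simp
  | add p q hp hq => simp only [map_add, hp, hq]
  | mul_X p n hp =>
    have h : ∀ a b : ℕ, pderiv a (pderiv b (X n : Poly)) = 0 := by
      intro a b
      rw [pderiv_X, Pi.single_apply]
      split_ifs <;> simp
    simp only [pderiv_mul, map_add, hp, h]
    ring

/-- The iterated partial derivative along a word `J` of coordinates. -/
def wordDeriv : List ℕ → Poly →ₗ[ℝ] Poly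
  | [] => LinearMap.id
  | i :: J => wordDeriv J ∘ₗ (pderiv i : Derivation ℝ Poly Poly).toLinearMap

@[simp]
lemma wordDeriv_nil (P : Poly) : wordDeriv [] P = P := rfl

lemma wordDeriv_cons (i : ℕ) (J : List ℕ) (P : Poly) :
    wordDeriv (i :: J) P = wordDeriv J (pderiv i P) := rfl

lemma pderiv_wordDeriv (i : ℕ) (J : List ℕ) (P : Poly) :
    pderiv i (wordDeriv J P) = wordDeriv (i :: J) P := by
  induction J generalizing P with
  | nil => rfl
  | cons j J ih => rw [wordDeriv_cons, ih, wordDeriv_cons, wordDeriv_cons, wordDeriv_cons,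
      pderiv_pderiv_comm]

/-- The words of length `a` in the letters of `S`. -/
def words (S : Finset ℕ) : ℕ → Finset (List ℕ)
  | 0 => {[]}
  | a + 1 => (S ×ˢ words S a).image fun x => x.1 :: x.2

lemma length_of_mem_words {a : ℕ} {J : List ℕ} (hJ : J ∈ words S a) : J.length = a := by
  induction a generalizing J with
  | zero => simp_all [words]
  | succ a ih =>
    obtain ⟨x, hx, rfl⟩ := Finset.mem_image.1 hJ
    simp [ih (Finset.mem_product.1 hx).2]

lemma sum_words_succ (a : ℕ) (f : List ℕ → ℝ) :
    ∑ J ∈ words S (a + 1), f J = ∑ i ∈ S, ∑ J ∈ words S a, f (i :: J) := by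
  rw [words, Finset.sum_image (fun x _ y _ h => by simpa [Prod.ext_iff] using h),
    Finset.sum_product]

lemma wordDeriv_mem_pchaos {p : ℕ} {P : Poly} (hP : P ∈ pchaos S p) (J : List ℕ) :
    wordDeriv J P ∈ pchaos S (p - J.length) := by
  induction J generalizing p P with
  | nil => simpa using hP
  | cons i J ih =>
    rw [wordDeriv_cons]
    have := ih (pderiv_mem_pchaos hP i)
    rwa [Nat.sub_sub, add_comm] at this

lemma wordDeriv_eq_zero {p : ℕ} {P : Poly} (hP : P ∈ pchaos S p) {J : List ℕ}
    (hJ : p < J.length) : wordDeriv J P = 0 := by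
  induction J generalizing p P with
  | nil => simp at hJ
  | cons i J ih =>
    rw [wordDeriv_cons]
    rcases Nat.eq_zero_or_pos p with rfl | hp
    · rw [pderiv_pchaos_zero hP, map_zero]
    · exact ih (pderiv_mem_pchaos hP i) (by simp at hJ; omega)

/-- Each derivative costs a factor of at most the degree, as `∑ E[(∂ᵢP)²] = E[Γ(P,P)] = p E[P²]`. -/
lemma sum_expect_wordDeriv_sq_le {p : ℕ} {P : Poly} (hP : P ∈ pchaos S p) (a : ℕ) :
    ∑ J ∈ words S a, expect (wordDeriv J P ^ 2) ≤ (p : ℝ) ^ a * expect (P ^ 2) := by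
  induction a generalizing p P with
  | zero => simp [words]
  | succ a ih =>
    rw [sum_words_succ]
    have h : ∀ i ∈ S, ∑ J ∈ words S a, expect (wordDeriv (i :: J) P ^ 2) ≤
        (p : ℝ) ^ a * expect (pderiv i P ^ 2) := by
      intro i _
      refine (ih (pderiv_mem_pchaos hP i)).trans ?_
      refine mul_le_mul_of_nonneg_right ?_ (expect_sq_nonneg _)
      exact pow_le_pow_left₀ (Nat.cast_nonneg _) (by exact_mod_cast Nat.sub_le p 1) a
    refine (Finset.sum_le_sum h).trans (le_of_eq ?_)
    rw [← Finset.mul_sum, ← expect_gam_self, expect_gam_self_of_mem hP]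
    ring

/-- When the degree of `G` exceeds that of `Y` by at least `|J|`, only the term in which all
derivatives fall on `G` contributes to the expectation of `∂_J (G Y)`. -/
lemma expect_wordDeriv_mul {g y : ℕ} {G Y : Poly} (hG : G ∈ pchaos S g) (hY : Y ∈ pchaos S y)
    {J : List ℕ} (h : y + J.length ≤ g) :
    expect (wordDeriv J (G * Y)) = expect (wordDeriv J G * Y) := by
  induction J generalizing g y G Y with
  | nil => rfl
  | cons i J ih =>
    simp only [List.length_cons] at h
    rw [wordDeriv_cons, pderiv_mul, map_add, map_add,
      ih (pderiv_mem_pchaos hG i) hY (by omega), ih hG (pderiv_mem_pchaos hY i) (by omega),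
      expect_mul_eq_zero _ (wordDeriv_mem_pchaos hG J) (pderiv_mem_pchaos hY i), add_zero]
    · rfl
    · omega

lemma expect_sq_le (P : Poly) : expect P ^ 2 ≤ expect (P ^ 2) := by
  have h := expect_mul_sq_le P 1
  rwa [one_pow, expect_one, mul_one, mul_one] at h

/-! ### From directional influences to trilinear bounds -/

lemma gam_insert_eq {N : ℕ} {p : ℕ} {P Q : Poly} (hP : P ∈ pchaos S p) (hN : N ∉ S) :
    gam (insert N S) P Q = gam S P Q := by
  rw [gam, Finset.sum_insert hN, pderiv_eq_zero_of_mem_pchaos hP hN, zero_mul, zero_add]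
  rfl

lemma X_mul_mem_pchaos {N q : ℕ} (hN : N ∉ S) {Q : Poly} (hQ : Q ∈ pchaos S q) :
    X N * Q ∈ pchaos (insert N S) (q + 1) := by
  induction hQ using Submodule.span_induction with
  | mem P h =>
    obtain ⟨k, rfl, hs, rfl⟩ := h
    rw [X_mul_herm, pderiv_herm_of_notMem fun h => hN (hs h), add_zero]
    have h := herm_mem_pchaos (S := insert N S) (k := k + Finsupp.single N 1)
      (Finsupp.support_add.trans (Finset.union_subset (hs.trans (Finset.subset_insert _ _))
        (Finsupp.support_single_subset.trans (by simp))))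
    simpa using h
  | zero => simp
  | add P Q _ _ hP hQ => rw [mul_add]; exact Submodule.add_mem _ hP hQ
  | smul c P _ hP => rw [mul_smul_comm]; exact Submodule.smul_mem _ _ hP

lemma expect_X_mul_sq {N : ℕ} {Q : Poly} (hQ : pderiv N Q = 0) :
    expect ((X N * Q) ^ 2) = expect (Q ^ 2) := by
  have h := expect_X_mul N (X N * Q ^ 2)
  rw [pderiv_mul, sq Q, pderiv_mul, hQ, pderiv_X_self] at h
  simp only [one_mul, mul_zero, zero_mul, add_zero] at h
  rw [sq Q, ← h]
  congr 1; ring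

/-- The squared directional influence of degree `q` of `P` is at most `r`. The test polynomials may
use coordinates outside `S`. -/
def InfluenceSqLE (S : Finset ℕ) (q : ℕ) (r : ℝ) (P : Poly) : Prop :=
  ∀ T, S ⊆ T → ∀ X ∈ pchaos T q, expect (gam T P X ^ 2) ≤ r * expect (X ^ 2)

/-- Multiplying a test polynomial by a fresh coordinate shows that directional influences increase
with the degree. -/
lemma InfluenceSqLE.of_succ {p q : ℕ} {r : ℝ} {P : Poly} (hP : P ∈ pchaos S p)
    (h : InfluenceSqLE S (q + 1) r P) : InfluenceSqLE S q r P := by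
  intro T hT Y hY
  obtain ⟨N, hN⟩ := Infinite.exists_notMem_finset T
  have hPT := pchaos_mono hT p hP
  have h1 := h (insert N T) (hT.trans (Finset.subset_insert _ _)) _ (X_mul_mem_pchaos hN hY)
  have hDP := pderiv_eq_zero_of_mem_pchaos hPT hN
  have hX : gam T P (X N) = 0 := Finset.sum_eq_zero fun i hi => by
    rw [pderiv_X_of_ne (by rintro rfl; exact hN hi), mul_zero]
  rw [gam_insert_eq hPT hN, gam_mul_right, hX, mul_zero, add_zero,
    expect_X_mul_sq (pderiv_eq_zero_of_mem_pchaos hY hN), expect_X_mul_sq] at h1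
  · exact h1
  · rw [gam, map_sum]
    refine Finset.sum_eq_zero fun i _ => ?_
    rw [pderiv_mul, pderiv_eq_zero_of_mem_pchaos (pderiv_mem_pchaos hPT i) hN,
      pderiv_eq_zero_of_mem_pchaos (pderiv_mem_pchaos hY i) hN]
    ring

lemma InfluenceSqLE.of_le {p q s : ℕ} (hsq : s ≤ q) {r : ℝ} {P : Poly} (hP : P ∈ pchaos S p)
    (h : InfluenceSqLE S q r P) : InfluenceSqLE S s r P := by
  induction q, hsq using Nat.le_induction with
  | base => exact h
  | succ q _ ih => exact ih (h.of_succ hP)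

lemma expect_gam_mul {p s t : ℕ} {P X Y : Poly} (hP : P ∈ pchaos S p) (hX : X ∈ pchaos S s)
    (hY : Y ∈ pchaos S t) (hst : s + t = p) :
    expect (gam S P X * Y) = s * expect (P * X * Y) := by
  have h := two_mul_gam hP hX
  have h2 := congrArg (fun Z => expect (Z * Y)) h
  simp only [add_mul, map_add, smul_mul_assoc, map_smul, smul_eq_mul] at h2
  rw [mul_assoc, expect_two_mul, mul_comm (ouOp _ _), expect_mul_ouOp_comm, ouOp_pchaos hY,
    mul_smul_comm, map_smul, smul_eq_mul] at h2
  have : (p : ℝ) = s + t := by exact_mod_cast hst.symm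
  rw [this] at h2
  linarith

/-- A bound on the directional influence of a degree `q ≥ ⌊p/2⌋` bounds the trilinear form
`E[P X Y]` for all splittings of the degree `p` of `P`, by the symmetry of this form. -/
lemma InfluenceSqLE.expect_mul_mul_sq_le {p q s t : ℕ} {r : ℝ} {P : Poly} (hP : P ∈ pchaos S p)
    (h : InfluenceSqLE S q r P) (hq : p / 2 ≤ q) (hs : 1 ≤ s) (ht : 1 ≤ t) (hst : s + t = p)
    {X Y : Poly} (hX : X ∈ pchaos S s) (hY : Y ∈ pchaos S t) :
    expect (P * X * Y) ^ 2 ≤ r * (expect (X ^ 2) * expect (Y ^ 2)) := by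
  have key : ∀ {s t : ℕ} {X Y : Poly}, 1 ≤ s → s + t = p → s ≤ q → X ∈ pchaos S s →
      Y ∈ pchaos S t → expect (P * X * Y) ^ 2 ≤ r * (expect (X ^ 2) * expect (Y ^ 2)) := by
    intro s t X Y hs hst hsq hX hY
    have h1 := h.of_le hsq hP S subset_rfl X hX
    have h2 := expect_mul_sq_le (gam S P X) Y
    rw [expect_gam_mul hP hX hY hst, mul_pow] at h2
    have h3 : (1 : ℝ) ≤ (s : ℝ) ^ 2 := one_le_pow₀ (by exact_mod_cast hs)
    have h4 := mul_le_mul_of_nonneg_right h1 (expect_sq_nonneg Y)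
    nlinarith [sq_nonneg (expect (P * X * Y))]
  -- If `s > q ≥ ⌊p/2⌋` then `t ≤ q`, and the roles of `X` and `Y` are exchanged.
  by_cases hsq : s ≤ q
  · exact key hs hst hsq hX hY
  · have := key ht (by omega) (by omega) hY hX
    rwa [mul_right_comm, mul_comm (expect (Y ^ 2))] at this

/-- The trilinear bound in terms of iterated derivatives: this controls the operator norm of the
flattened coefficient tensor of `P`. -/
lemma InfluenceSqLE.sum_expect_wordDeriv_mul_sq_le {p q a : ℕ} {r : ℝ} (hr : 0 ≤ r) {P : Poly}
    (hP : P ∈ pchaos S p) (h : InfluenceSqLE S q r P) (hq : p / 2 ≤ q) (ha : 1 ≤ a) (hap : a < p)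
    {Y : Poly} (hY : Y ∈ pchaos S (p - a)) :
    ∑ J ∈ words S a, expect (wordDeriv J P * Y) ^ 2 ≤ (p : ℝ) ^ p * r * expect (Y ^ 2) := by
  -- Only the component `R a` of degree `a` of `P Y` contributes to `E[∂_J (P Y)]` for `|J| = a`,
  -- and testing the trilinear form with `X = R a` bounds its norm.
  obtain ⟨R, hR, hPY⟩ := exists_chaos_decomp
    (mul_mem_pchaosLE (pchaos_le_pchaosLE le_rfl hP) (pchaos_le_pchaosLE le_rfl hY))
  have ha' : a ∈ Finset.range (p + (p - a) + 1) := Finset.mem_range.2 (by omega)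
  have h1 : ∀ J ∈ words S a, expect (wordDeriv J P * Y) ^ 2 ≤ expect (wordDeriv J (R a) ^ 2) := by
    intro J hJ
    have hl := length_of_mem_words hJ
    rw [← expect_wordDeriv_mul hP hY (by omega), hPY, map_sum, map_sum, Finset.sum_eq_single a]
    · exact expect_sq_le _
    · intro m _ hm
      rcases lt_or_gt_of_ne hm with hlt | hgt
      · rw [wordDeriv_eq_zero (hR m) (by omega), map_zero]
      · exact expect_eq_zero (by omega) (wordDeriv_mem_pchaos (hR m) J)
    · exact fun h => absurd ha' h
  have h2 : expect (P * R a * Y) = expect (R a ^ 2) := by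
    rw [mul_right_comm, hPY, Finset.sum_mul, map_sum, Finset.sum_eq_single a
      (fun m _ hm => expect_mul_eq_zero hm (hR m) (hR a)) (fun h => absurd ha' h), sq]
  have h3 := h.expect_mul_mul_sq_le hP hq ha (by omega : 1 ≤ p - a) (by omega) (hR a) hY
  rw [h2] at h3
  have h4 : expect (R a ^ 2) ≤ r * expect (Y ^ 2) := by
    rcases (expect_sq_nonneg (R a)).eq_or_lt with h0 | h0
    · rw [← h0]; exact mul_nonneg hr (expect_sq_nonneg _)
    · refine le_of_mul_le_mul_left ?_ h0
      nlinarith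
  have h5 : (a : ℝ) ^ a ≤ (p : ℝ) ^ p := by
    have : a ^ a ≤ p ^ p := (Nat.pow_le_pow_left hap.le a).trans
      (Nat.pow_le_pow_right (by omega) hap.le)
    exact_mod_cast this
  calc _ ≤ ∑ J ∈ words S a, expect (wordDeriv J (R a) ^ 2) := Finset.sum_le_sum h1
    _ ≤ (a : ℝ) ^ a * expect (R a ^ 2) := sum_expect_wordDeriv_sq_le (hR a) a
    _ ≤ (p : ℝ) ^ p * (r * expect (Y ^ 2)) :=
      mul_le_mul h5 h4 (expect_sq_nonneg _) (by positivity)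
    _ = _ := by ring

/-! ### Iterating the Poincaré inequality -/

lemma pderiv_gam (i : ℕ) (P Q : Poly) :
    pderiv i (gam S P Q) = gam S (pderiv i P) Q + gam S P (pderiv i Q) := by
  simp only [gam, map_sum, ← Finset.sum_add_distrib, pderiv_mul]
  exact Finset.sum_congr rfl fun j _ => by
    rw [pderiv_pderiv_comm i j P, pderiv_pderiv_comm i j Q]

lemma expect_add_sq_le (P Q : Poly) :
    expect ((P + Q) ^ 2) ≤ 2 * expect (P ^ 2) + 2 * expect (Q ^ 2) := by
  simpa using expect_sub_sq_le P (-Q)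

lemma expect_gam_sq_le_of_poincare {a b : ℕ} {P Q : Poly} (hP : P ∈ pchaos S a)
    (hQ : Q ∈ pchaos S b) :
    expect (gam S P Q ^ 2) ≤ expect (gam S P Q) ^ 2 +
      (2 * ∑ i ∈ S, expect (gam S (pderiv i P) Q ^ 2) +
        2 * ∑ i ∈ S, expect (gam S P (pderiv i Q) ^ 2)) := by
  refine (poincare (gam_mem_pchaosLE (pchaos_le_pchaosLE le_rfl hP)
    (pchaos_le_pchaosLE le_rfl hQ))).trans (add_le_add le_rfl ?_)
  rw [expect_gam_self, Finset.mul_sum, Finset.mul_sum, ← Finset.sum_add_distrib]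
  refine Finset.sum_le_sum fun i _ => ?_
  rw [pderiv_gam]
  exact expect_add_sq_le _ _

/-- The total second moment of `Γ(∂_J P, ∂_K P)` over words `J`, `K` of lengths `a`, `b`. -/
def gamWords (S : Finset ℕ) (P : Poly) (a b : ℕ) : ℝ :=
  ∑ J ∈ words S a, ∑ K ∈ words S b, expect (gam S (wordDeriv J P) (wordDeriv K P) ^ 2)

lemma gam_eq_zero_of_mem_zero {P : Poly} (hP : P ∈ pchaos S 0) (Q : Poly) : gam S P Q = 0 :=
  Finset.sum_eq_zero fun i _ => by rw [pderiv_pchaos_zero hP, zero_mul]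

/-- One step of the iteration: the Poincaré inequality for all `Γ(∂_J P, ∂_K P)`. -/
lemma gamWords_le_add {p : ℕ} {P : Poly} (hP : P ∈ pchaos S p) (a b : ℕ) :
    gamWords S P a b ≤
      (∑ J ∈ words S a, ∑ K ∈ words S b, expect (gam S (wordDeriv J P) (wordDeriv K P)) ^ 2) +
        (2 * gamWords S P (a + 1) b + 2 * gamWords S P a (b + 1)) := by
  have h1 : gamWords S P (a + 1) b = ∑ J ∈ words S a, ∑ K ∈ words S b, ∑ i ∈ S,
      expect (gam S (pderiv i (wordDeriv J P)) (wordDeriv K P) ^ 2) := by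
    rw [gamWords, sum_words_succ, Finset.sum_comm]
    refine Finset.sum_congr rfl fun J _ => ?_
    rw [Finset.sum_comm]
    simp only [pderiv_wordDeriv]
  have h2 : gamWords S P a (b + 1) = ∑ J ∈ words S a, ∑ K ∈ words S b, ∑ i ∈ S,
      expect (gam S (wordDeriv J P) (pderiv i (wordDeriv K P)) ^ 2) := by
    rw [gamWords]
    refine Finset.sum_congr rfl fun J _ => ?_
    rw [sum_words_succ, Finset.sum_comm]
    simp only [pderiv_wordDeriv]
  rw [h1, h2]
  simp only [gamWords, Finset.mul_sum, ← Finset.sum_add_distrib]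
  refine Finset.sum_le_sum fun J _ => Finset.sum_le_sum fun K _ => ?_
  have h := expect_gam_sq_le_of_poincare (wordDeriv_mem_pchaos hP J) (wordDeriv_mem_pchaos hP K)
  simpa only [Finset.mul_sum, ← Finset.sum_add_distrib] using h

/-- The expectation of `Γ(∂_J P, ∂_K P)` is a multiple of `E[∂_J P ∂_K P]`. It vanishes for words of
different lengths, and for words of equal length the influence controls it. -/
lemma InfluenceSqLE.sum_expect_gam_wordDeriv_sq_le {p q a b : ℕ} {r : ℝ} (hr : 0 ≤ r) {P : Poly}
    (hP : P ∈ pchaos S p) (h : InfluenceSqLE S q r P) (hq : p / 2 ≤ q) (hab : 1 ≤ a + b)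
    (ha : a < p) (hb : b < p) :
    ∑ J ∈ words S a, ∑ K ∈ words S b, expect (gam S (wordDeriv J P) (wordDeriv K P)) ^ 2 ≤
      (p : ℝ) ^ 2 * ((p : ℝ) ^ p * (p : ℝ) ^ p) * (r * expect (P ^ 2)) := by
  have hE := expect_sq_nonneg P
  have e : ∀ J ∈ words S a, ∀ K ∈ words S b,
      expect (gam S (wordDeriv J P) (wordDeriv K P)) ^ 2 =
        ((p - b : ℕ) : ℝ) ^ 2 * expect (wordDeriv J P * wordDeriv K P) ^ 2 := by
    intro J _ K hK
    have hK' := wordDeriv_mem_pchaos hP K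
    rw [length_of_mem_words hK] at hK'
    rw [expect_gam_of_mem hK', mul_pow]
  rw [Finset.sum_congr rfl fun J hJ => Finset.sum_congr rfl (e J hJ)]
  by_cases hne : a = b
  · subst hne
    have h1 : ∀ K ∈ words S a, ∑ J ∈ words S a, ((p - a : ℕ) : ℝ) ^ 2 *
        expect (wordDeriv J P * wordDeriv K P) ^ 2 ≤
          (p : ℝ) ^ 2 * ((p : ℝ) ^ p * r) * expect (wordDeriv K P ^ 2) := by
      intro K hK
      have hK' := wordDeriv_mem_pchaos hP K
      rw [length_of_mem_words hK] at hK'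
      rw [← Finset.mul_sum, mul_assoc]
      refine mul_le_mul ?_
        (h.sum_expect_wordDeriv_mul_sq_le hr hP hq (by omega) ha hK')
        (Finset.sum_nonneg fun _ _ => sq_nonneg _) (by positivity)
      exact pow_le_pow_left₀ (Nat.cast_nonneg _) (by exact_mod_cast Nat.sub_le p a) 2
    rw [Finset.sum_comm]
    refine (Finset.sum_le_sum h1).trans ?_
    rw [← Finset.mul_sum]
    have h2 := sum_expect_wordDeriv_sq_le hP a
    have h3 : (p : ℝ) ^ a ≤ (p : ℝ) ^ p :=
      pow_le_pow_right₀ (by exact_mod_cast (by omega : 1 ≤ p)) ha.le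
    calc _ ≤ (p : ℝ) ^ 2 * ((p : ℝ) ^ p * r) * ((p : ℝ) ^ p * expect (P ^ 2)) :=
          mul_le_mul_of_nonneg_left (h2.trans (mul_le_mul_of_nonneg_right h3 hE)) (by positivity)
      _ = _ := by ring
  · rw [Finset.sum_eq_zero]
    · positivity
    · intro J hJ
      refine Finset.sum_eq_zero fun K hK => ?_
      rw [expect_mul_eq_zero _ (wordDeriv_mem_pchaos hP J) (wordDeriv_mem_pchaos hP K)]
      · ring
      · rw [length_of_mem_words hJ, length_of_mem_words hK]; omega

/-- Iterating the Poincaré inequality on `Γ(∂_J P, ∂_K P)` until all derivatives vanish, with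
`n = 2p - a - b` steps left; the base `5 = 1 + 2 + 2` adds up the weights of one step. -/
lemma InfluenceSqLE.gamWords_le {p q : ℕ} {r : ℝ} (hr : 0 ≤ r) {P : Poly}
    (hP : P ∈ pchaos S p) (h : InfluenceSqLE S q r P) (hq : p / 2 ≤ q) (n : ℕ) :
    ∀ a b : ℕ, a ≤ p → b ≤ p → 1 ≤ a + b → a + b + n = 2 * p →
      gamWords S P a b ≤
        5 ^ n * ((p : ℝ) ^ 2 * ((p : ℝ) ^ p * (p : ℝ) ^ p) * (r * expect (P ^ 2))) := by
  set B := (p : ℝ) ^ 2 * ((p : ℝ) ^ p * (p : ℝ) ^ p) * (r * expect (P ^ 2)) with hB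
  have hB0 : 0 ≤ B := mul_nonneg (by positivity) (mul_nonneg hr (expect_sq_nonneg P))
  have hzero : ∀ a b : ℕ, a = p ∨ b = p → gamWords S P a b = 0 := by
    intro a b hab
    refine Finset.sum_eq_zero fun J hJ => Finset.sum_eq_zero fun K hK => ?_
    have hJ' := wordDeriv_mem_pchaos hP J
    have hK' := wordDeriv_mem_pchaos hP K
    rw [length_of_mem_words hJ] at hJ'
    rw [length_of_mem_words hK] at hK'
    rcases hab with rfl | rfl
    · rw [Nat.sub_self] at hJ'
      rw [gam_eq_zero_of_mem_zero hJ']; simp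
    · rw [Nat.sub_self] at hK'
      rw [gam_comm, gam_eq_zero_of_mem_zero hK']; simp
  induction n with
  | zero =>
    intro a b ha hb _ hn
    rw [hzero a b (by omega)]
    positivity
  | succ n ih =>
    intro a b ha hb hab hn
    by_cases hz : a = p ∨ b = p
    · rw [hzero a b hz]; positivity
    · have h1 := gamWords_le_add hP a b
      have h2 := h.sum_expect_gam_wordDeriv_sq_le hr hP hq hab (by omega) (by omega)
      have h3 := ih (a + 1) b (by omega) hb (by omega) (by omega)
      have h4 := ih a (b + 1) ha (by omega) (by omega) (by omega)
      have h5 : (1 : ℝ) ≤ 5 ^ n := one_le_pow₀ (by norm_num)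
      rw [pow_succ]
      nlinarith [mul_le_mul_of_nonneg_right h5 hB0]

/-- A directional influence of a degree `q ≥ ⌊p/2⌋` controls the variance of `Γ(P,P)`. -/
lemma InfluenceSqLE.expect_gam_sub_sq_le {p q : ℕ} (hp : 1 ≤ p) {r : ℝ} (hr : 0 ≤ r) {P : Poly}
    (hP : P ∈ pchaos S p) (h : InfluenceSqLE S q r P) (hq : p / 2 ≤ q) :
    expect ((gam S P P - MvPolynomial.C (p * expect (P ^ 2))) ^ 2) ≤
      4 * 5 ^ (2 * p) * ((p : ℝ) ^ 2 * ((p : ℝ) ^ p * (p : ℝ) ^ p)) * (r * expect (P ^ 2)) := by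
  have h1 := expect_gam_sq_le_of_poincare hP hP
  have h2 := h.gamWords_le hr hP hq (2 * p - 1) 1 0 hp (by omega) (by omega) (by omega)
  have e1 : gamWords S P 1 0 = ∑ i ∈ S, expect (gam S (pderiv i P) P ^ 2) := by
    rw [gamWords, sum_words_succ]
    simp [words, wordDeriv_cons]
  have e2 : ∑ i ∈ S, expect (gam S P (pderiv i P) ^ 2) = gamWords S P 1 0 := by
    rw [e1]
    exact Finset.sum_congr rfl fun i _ => by rw [gam_comm]
  rw [e2, ← e1] at h1
  rw [expect_sub_C_sq, expect_gam_self_of_mem hP]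
  rw [expect_gam_self_of_mem hP] at h1
  set B := (p : ℝ) ^ 2 * ((p : ℝ) ^ p * (p : ℝ) ^ p) with hB
  have hB0 : 0 ≤ B * (r * expect (P ^ 2)) :=
    mul_nonneg (by positivity) (mul_nonneg hr (expect_sq_nonneg P))
  have h5 : (5 : ℝ) ^ (2 * p - 1) ≤ 5 ^ (2 * p) := pow_le_pow_right₀ (by norm_num) (by omega)
  have h6 := mul_le_mul_of_nonneg_right h5 hB0
  nlinarith

end

/-! ### Polynomials as square integrable random variables -/

lemma memLp_two_eval (P : Poly) :
    MemLp (fun ω : Space => MvPolynomial.eval ω P) 2 gaussianProd := by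
  simpa using memLp_eval P 1

/-- The class in `L2` of a polynomial in the Gaussian coordinates. -/
def ofPoly : Poly →ₗ[ℝ] L2 where
  toFun P := (memLp_two_eval P).toLp _
  map_add' P Q := by
    rw [← MemLp.toLp_add]
    exact MemLp.toLp_congr _ _ (ae_of_all _ fun ω => by simp)
  map_smul' c P := by
    rw [RingHom.id_apply, ← MemLp.toLp_const_smul]
    exact MemLp.toLp_congr _ _ (ae_of_all _ fun ω => by simp [MvPolynomial.smul_eval])

lemma coeFn_ofPoly (P : Poly) : ofPoly P =ᵐ[gaussianProd] fun ω => MvPolynomial.eval ω P :=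
  (memLp_two_eval P).coeFn_toLp

lemma inner_ofPoly (P Q : Poly) : inner ℝ (ofPoly P) (ofPoly Q) = expect (P * Q) := by
  rw [L2.inner_def, expect_eq_integral]
  refine integral_congr_ae ?_
  filter_upwards [coeFn_ofPoly P, coeFn_ofPoly Q] with ω h1 h2
  rw [h1, h2, map_mul]
  simp [mul_comm]

lemma norm_ofPoly_sq (P : Poly) : ‖ofPoly P‖ ^ 2 = expect (P ^ 2) := by
  rw [← real_inner_self_eq_norm_sq, inner_ofPoly, sq]

lemma ofPoly_mem_chaos {S : Finset ℕ} {p : ℕ} {P : Poly} (hP : P ∈ pchaos S p) :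
    ofPoly P ∈ chaos p := by
  refine Submodule.le_topologicalClosure _ ?_
  induction hP using Submodule.span_induction with
  | mem P h =>
    obtain ⟨k, hk, -, rfl⟩ := h
    refine Submodule.subset_span ⟨k, hk, (coeFn_ofPoly _).trans (ae_of_all _ fun ω => ?_)⟩
    exact eval_herm k ω
  | zero => simp
  | add P Q _ _ hP hQ => rw [map_add]; exact Submodule.add_mem _ hP hQ
  | smul c P _ hP => rw [map_smul]; exact Submodule.smul_mem _ _ hP

/-- Every element of a Wiener chaos is a limit of polynomials of the same chaos. -/
lemma exists_seq_of_mem_chaos {p : ℕ} {F : L2} (hF : F ∈ chaos p) :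
    ∃ (S : ℕ → Finset ℕ) (P : ℕ → Poly), (∀ n, P n ∈ pchaos (S n) p) ∧
      Tendsto (fun n => ofPoly (P n)) atTop (𝓝 F) := by
  have key : ∀ Y ∈ Submodule.span ℝ
      {Y : L2 | ∃ k : ℕ →₀ ℕ, k.degree = p ∧ Y =ᵐ[gaussianProd] hermiteProd k},
      ∃ (S : Finset ℕ) (P : Poly), P ∈ pchaos S p ∧ ofPoly P = Y := by
    intro Y hY
    induction hY using Submodule.span_induction with
    | mem Y h =>
      obtain ⟨k, hk, hY⟩ := h
      refine ⟨k.support, herm k, hk ▸ herm_mem_pchaos subset_rfl, Lp.ext ?_⟩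
      filter_upwards [coeFn_ofPoly (herm k), hY] with ω h1 h2
      rw [h1, h2, eval_herm]
    | zero => exact ⟨∅, 0, Submodule.zero_mem _, map_zero _⟩
    | add Y Z _ _ hY hZ =>
      obtain ⟨S, P, hP, rfl⟩ := hY
      obtain ⟨T, Q, hQ, rfl⟩ := hZ
      exact ⟨S ∪ T, P + Q, Submodule.add_mem _ (pchaos_mono Finset.subset_union_left _ hP)
        (pchaos_mono Finset.subset_union_right _ hQ), map_add _ _ _⟩
    | smul c Y _ hY =>
      obtain ⟨S, P, hP, rfl⟩ := hY
      exact ⟨S, c • P, Submodule.smul_mem _ _ hP, map_smul _ _ _⟩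
  have hF' : F ∈ closure ((Submodule.span ℝ {Y : L2 | ∃ k : ℕ →₀ ℕ, k.degree = p ∧
      Y =ᵐ[gaussianProd] hermiteProd k} : Submodule ℝ L2) : Set L2) := hF
  obtain ⟨Y, hY, hlim⟩ := mem_closure_iff_seq_limit.1 hF'
  choose S P hP hPY using fun n => key (Y n) (hY n)
  exact ⟨S, P, hP, by simpa only [hPY] using hlim⟩

/-! ### Orthogonal projections on the chaoses -/

lemma inner_eq_zero_of_mem_chaos {p q : ℕ} (hpq : p ≠ q) {F X : L2} (hF : F ∈ chaos p)
    (hX : X ∈ chaos q) : inner ℝ F X = 0 := by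
  obtain ⟨S, P, hP, hPF⟩ := exists_seq_of_mem_chaos hF
  obtain ⟨T, Q, hQ, hQX⟩ := exists_seq_of_mem_chaos hX
  refine tendsto_nhds_unique (hPF.inner hQX) ?_
  refine tendsto_const_nhds.congr fun n => ?_
  rw [inner_ofPoly, expect_mul_eq_zero hpq (pchaos_mono Finset.subset_union_left _ (hP n))
    (pchaos_mono (Finset.subset_union_right (s₁ := S n)) _ (hQ n))]

lemma J_mem (m : ℕ) (F : L2) : J m F ∈ chaos m := Submodule.starProjection_apply_mem _ _

lemma J_of_mem {m : ℕ} {F : L2} (hF : F ∈ chaos m) : J m F = F :=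
  Submodule.starProjection_eq_self_iff.2 hF

lemma J_of_mem_of_ne {m q : ℕ} (h : q ≠ m) {F : L2} (hF : F ∈ chaos q) : J m F = 0 :=
  (Submodule.starProjection_apply_eq_zero_iff (chaos m)).2 fun _ hX =>
    inner_eq_zero_of_mem_chaos h.symm hX hF

lemma chaos_le_chaosLE {m d : ℕ} (h : m ≤ d) : chaos m ≤ chaosLE d :=
  le_biSup chaos (Finset.mem_range.2 (Nat.lt_succ_of_le h))

lemma mem_chaosLE_iff {d : ℕ} {F : L2} :
    F ∈ chaosLE d ↔ ∑ m ∈ Finset.range (d + 1), J m F = F := by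
  constructor
  · intro hF
    obtain ⟨R, rfl⟩ := (Submodule.mem_iSup_finset_iff_exists_sum _ _).1 hF
    refine Finset.sum_congr rfl fun m hm => ?_
    rw [map_sum, Finset.sum_eq_single m (fun j _ hj => J_of_mem_of_ne hj (R j).2)
      (fun h => absurd hm h), J_of_mem (R m).2]
  · intro hF
    rw [← hF]
    exact Submodule.sum_mem _ fun m hm =>
      chaos_le_chaosLE (Nat.lt_succ_iff.1 (Finset.mem_range.1 hm)) (J_mem m F)

lemma J_eq_zero_of_lt {d m : ℕ} (h : d < m) {F : L2} (hF : F ∈ chaosLE d) : J m F = 0 := by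
  rw [← mem_chaosLE_iff.1 hF, map_sum]
  refine Finset.sum_eq_zero fun j hj => J_of_mem_of_ne ?_ (J_mem j F)
  have := Finset.mem_range.1 hj
  omega

lemma isClosed_chaosLE (d : ℕ) : IsClosed (chaosLE d : Set L2) := by
  have : (chaosLE d : Set L2) = {F | ∑ m ∈ Finset.range (d + 1), J m F = F} := by
    ext F; exact mem_chaosLE_iff
  rw [this]
  exact isClosed_eq (by fun_prop) continuous_id

lemma ofPoly_mem_chaosLE {S : Finset ℕ} {d : ℕ} {P : Poly} (hP : P ∈ pchaosLE S d) :
    ofPoly P ∈ chaosLE d := by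
  obtain ⟨R, hR, rfl⟩ := exists_chaos_decomp hP
  rw [map_sum]
  exact Submodule.sum_mem _ fun m hm =>
    chaos_le_chaosLE (Nat.lt_succ_iff.1 (Finset.mem_range.1 hm)) (ofPoly_mem_chaos (hR m))

lemma pchaosLE_mono_left {S T : Finset ℕ} (h : S ⊆ T) (d : ℕ) : pchaosLE S d ≤ pchaosLE T d :=
  iSup₂_mono fun m _ => pchaos_mono h m

lemma exists_seq_of_mem_chaosLE {d : ℕ} {F : L2} (hF : F ∈ chaosLE d) :
    ∃ (S : ℕ → Finset ℕ) (P : ℕ → Poly), (∀ n, P n ∈ pchaosLE (S n) d) ∧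
      Tendsto (fun n => ofPoly (P n)) atTop (𝓝 F) := by
  choose S P hP hlim using fun m => exists_seq_of_mem_chaos (J_mem m F)
  refine ⟨fun n => (Finset.range (d + 1)).biUnion fun m => S m n,
    fun n => ∑ m ∈ Finset.range (d + 1), P m n, fun n => ?_, ?_⟩
  · refine Submodule.sum_mem _ fun m hm => ?_
    exact pchaos_le_pchaosLE (Nat.lt_succ_iff.1 (Finset.mem_range.1 hm))
      (pchaos_mono (Finset.subset_biUnion_of_mem (fun m => S m n) hm) _ (hP m n))
  · have h := tendsto_finsetSum (Finset.range (d + 1)) fun m _ => hlim m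
    rw [mem_chaosLE_iff.1 hF] at h
    simpa only [map_sum] using h

/-! ### The generator on finite sums of chaoses -/

/-- The operator with eigenvalue `-m` on the chaos of degree `m ≤ d`, and zero beyond degree `d`. -/
def genLE (d : ℕ) : L2 →L[ℝ] L2 := ∑ m ∈ Finset.range (d + 1), (-(m : ℝ)) • J m

lemma L_eq_genLE {d : ℕ} {F : L2} (hF : F ∈ chaosLE d) : L F = genLE d F := by
  rw [L, tsum_eq_sum (s := Finset.range (d + 1)), genLE, _root_.sum_apply]
  · rfl
  · intro m hm
    rw [J_eq_zero_of_lt (by simpa using hm) hF, smul_zero]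

lemma L_of_mem {p : ℕ} {F : L2} (hF : F ∈ chaos p) : L F = (-(p : ℝ)) • F := by
  rw [L, tsum_eq_single p fun m hm => by rw [J_of_mem_of_ne hm.symm hF, smul_zero], J_of_mem hF]

lemma genLE_ofPoly {S : Finset ℕ} {d : ℕ} {P : Poly} (hP : P ∈ pchaosLE S d) :
    genLE d (ofPoly P) = ofPoly (ouOp S P) := by
  rw [← L_eq_genLE (ofPoly_mem_chaosLE hP), L_eq_genLE (ofPoly_mem_chaosLE hP)]
  obtain ⟨R, hR, rfl⟩ := exists_chaos_decomp hP
  rw [ouOp_sum hR, map_sum, map_sum, map_sum]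
  refine Finset.sum_congr rfl fun m hm => ?_
  rw [← L_eq_genLE (chaos_le_chaosLE (Nat.lt_succ_iff.1 (Finset.mem_range.1 hm))
    (ofPoly_mem_chaos (hR m))), L_of_mem (ofPoly_mem_chaos (hR m)), map_smul]

/-! ### Products of elements of finite sums of chaoses -/

lemma toL2_eq {f : Space → ℝ} {Y : L2} (h : Y =ᵐ[gaussianProd] f) : toL2 f = Y := by
  have hf : MemLp f 2 gaussianProd := (Lp.memLp Y).ae_eq h
  rw [toL2, dif_pos hf]
  exact Lp.ext (hf.coeFn_toLp.trans h.symm)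

lemma coeFn_toL2 {f : Space → ℝ} (hf : MemLp f 2 gaussianProd) : toL2 f =ᵐ[gaussianProd] f := by
  rw [toL2, dif_pos hf]
  exact hf.coeFn_toLp

/-- The class in `L2` of the product of two random variables, and `0` if the product is not square
integrable. -/
def mulL2 (F X : L2) : L2 := toL2 fun ω => F ω * X ω

lemma mulL2_ofPoly (P Q : Poly) : mulL2 (ofPoly P) (ofPoly Q) = ofPoly (P * Q) := by
  refine toL2_eq ?_
  filter_upwards [coeFn_ofPoly P, coeFn_ofPoly Q, coeFn_ofPoly (P * Q)] with ω h1 h2 h3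
  rw [h1, h2, h3, map_mul]

/-- A bound for the norm of the multiplication on sums of chaoses of degree at most `a` and `b`. -/
def mulConst (a b : ℕ) : ℝ := √(√(hyperConst a) * √(hyperConst b))

lemma mulConst_nonneg (a b : ℕ) : 0 ≤ mulConst a b := Real.sqrt_nonneg _

lemma norm_ofPoly_mul_le {S T : Finset ℕ} {a b : ℕ} {P Q : Poly} (hP : P ∈ pchaosLE S a)
    (hQ : Q ∈ pchaosLE T b) : ‖ofPoly (P * Q)‖ ≤ mulConst a b * (‖ofPoly P‖ * ‖ofPoly Q‖) := by
  have h := expect_sq_mul_sq_le (pchaosLE_mono_left Finset.subset_union_left _ hP)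
    (pchaosLE_mono_left (Finset.subset_union_right (s₁ := S)) _ hQ)
  rw [← norm_ofPoly_sq, ← norm_ofPoly_sq, ← norm_ofPoly_sq] at h
  refine le_of_sq_le_sq ?_ (mul_nonneg (mulConst_nonneg a b) (by positivity))
  rw [mul_pow, mulConst, Real.sq_sqrt (by positivity), mul_pow]
  exact h

/-- The product estimate for polynomials passes to the limit by Fatou's lemma. -/
lemma eLpNorm_mul_le {a b : ℕ} {F X : L2} (hF : F ∈ chaosLE a) (hX : X ∈ chaosLE b) :
    eLpNorm (fun ω => F ω * X ω) 2 gaussianProd ≤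
      ENNReal.ofReal (mulConst a b * (‖F‖ * ‖X‖)) := by
  obtain ⟨S, P, hP, hPF⟩ := exists_seq_of_mem_chaosLE hF
  obtain ⟨T, Q, hQ, hQX⟩ := exists_seq_of_mem_chaosLE hX
  obtain ⟨ns, hns, h1⟩ := (tendstoInMeasure_of_tendsto_Lp hPF).exists_seq_tendsto_ae
  obtain ⟨ms, hms, h2⟩ := (tendstoInMeasure_of_tendsto_Lp
    (hQX.comp hns.tendsto_atTop)).exists_seq_tendsto_ae
  set φ : ℕ → ℕ := fun n => ns (ms n) with hφ
  have hφt : Tendsto φ atTop atTop := hns.tendsto_atTop.comp hms.tendsto_atTop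
  have hae : ∀ᵐ ω ∂gaussianProd, Tendsto (fun n => MvPolynomial.eval ω (P (φ n) * Q (φ n))) atTop
      (𝓝 (F ω * X ω)) := by
    have hc1 : ∀ᵐ ω ∂gaussianProd, ∀ n, ofPoly (P n) ω = MvPolynomial.eval ω (P n) :=
      ae_all_iff.2 fun n => coeFn_ofPoly (P n)
    have hc2 : ∀ᵐ ω ∂gaussianProd, ∀ n, ofPoly (Q n) ω = MvPolynomial.eval ω (Q n) :=
      ae_all_iff.2 fun n => coeFn_ofPoly (Q n)
    filter_upwards [h1, h2, hc1, hc2] with ω h1 h2 hc1 hc2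
    have h3 := (h1.comp hms.tendsto_atTop).mul h2
    refine h3.congr fun n => ?_
    simp only [Function.comp_apply, hc1, hc2, map_mul, hφ]
  have hle := Lp.eLpNorm_lim_le_liminf_eLpNorm (p := 2)
    (fun n => (measurable_eval (P (φ n) * Q (φ n))).aestronglyMeasurable) _ hae
  refine hle.trans ?_
  have hlim : Tendsto (fun n => ENNReal.ofReal
      (mulConst a b * (‖ofPoly (P (φ n))‖ * ‖ofPoly (Q (φ n))‖))) atTop
      (𝓝 (ENNReal.ofReal (mulConst a b * (‖F‖ * ‖X‖)))) :=
    ENNReal.tendsto_ofReal (((hPF.comp hφt).norm.mul (hQX.comp hφt).norm).const_mul _)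
  rw [← hlim.liminf_eq]
  refine liminf_le_liminf (Eventually.of_forall fun n => ?_)
  rw [← eLpNorm_congr_ae (coeFn_ofPoly (P (φ n) * Q (φ n))), ← Lp.enorm_def, ← ofReal_norm]
  exact ENNReal.ofReal_le_ofReal (norm_ofPoly_mul_le (hP _) (hQ _))

lemma memLp_mul {a b : ℕ} {F X : L2} (hF : F ∈ chaosLE a) (hX : X ∈ chaosLE b) :
    MemLp (fun ω => F ω * X ω) 2 gaussianProd :=
  ⟨(Lp.aestronglyMeasurable F).mul (Lp.aestronglyMeasurable X),
    (eLpNorm_mul_le hF hX).trans_lt ENNReal.ofReal_lt_top⟩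

lemma coeFn_mulL2 {a b : ℕ} {F X : L2} (hF : F ∈ chaosLE a) (hX : X ∈ chaosLE b) :
    mulL2 F X =ᵐ[gaussianProd] fun ω => F ω * X ω :=
  coeFn_toL2 (memLp_mul hF hX)

lemma norm_mulL2_le {a b : ℕ} {F X : L2} (hF : F ∈ chaosLE a) (hX : X ∈ chaosLE b) :
    ‖mulL2 F X‖ ≤ mulConst a b * (‖F‖ * ‖X‖) := by
  have h := eLpNorm_mul_le hF hX
  rw [← eLpNorm_congr_ae (coeFn_mulL2 hF hX)] at h
  rw [Lp.norm_def]
  exact ENNReal.toReal_le_of_le_ofReal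
    (mul_nonneg (mulConst_nonneg _ _) (mul_nonneg (norm_nonneg _) (norm_nonneg _))) h

lemma mulL2_sub_mulL2 {a b : ℕ} {F F' X X' : L2} (hF : F ∈ chaosLE a) (hF' : F' ∈ chaosLE a)
    (hX : X ∈ chaosLE b) (hX' : X' ∈ chaosLE b) :
    mulL2 F X - mulL2 F' X' = mulL2 (F - F') X + mulL2 F' (X - X') := by
  refine Lp.ext ?_
  filter_upwards [Lp.coeFn_sub (mulL2 F X) (mulL2 F' X'),
    Lp.coeFn_add (mulL2 (F - F') X) (mulL2 F' (X - X')), coeFn_mulL2 hF hX, coeFn_mulL2 hF' hX',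
    coeFn_mulL2 (Submodule.sub_mem _ hF hF') hX, coeFn_mulL2 hF' (Submodule.sub_mem _ hX hX'),
    Lp.coeFn_sub F F', Lp.coeFn_sub X X'] with ω h1 h2 h3 h4 h5 h6 h7 h8
  rw [h1, h2, Pi.sub_apply, Pi.add_apply, h3, h4, h5, h6, h7, h8, Pi.sub_apply, Pi.sub_apply]
  ring

/-- The multiplication is continuous on finite sums of chaoses. -/
lemma tendsto_mulL2 {a b : ℕ} {F X : L2} (hF : F ∈ chaosLE a) (hX : X ∈ chaosLE b)
    {u v : ℕ → L2} (hu : ∀ n, u n ∈ chaosLE a) (hv : ∀ n, v n ∈ chaosLE b)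
    (huF : Tendsto u atTop (𝓝 F)) (hvX : Tendsto v atTop (𝓝 X)) :
    Tendsto (fun n => mulL2 (u n) (v n)) atTop (𝓝 (mulL2 F X)) := by
  rw [tendsto_iff_norm_sub_tendsto_zero]
  have h1 : Tendsto (fun n => mulConst a b * (‖u n - F‖ * ‖v n‖) + mulConst a b * (‖F‖ * ‖v n - X‖))
      atTop (𝓝 (mulConst a b * (0 * ‖X‖) + mulConst a b * (‖F‖ * 0))) :=
    (((tendsto_iff_norm_sub_tendsto_zero.1 huF).mul hvX.norm).const_mul _).add
      (((tendsto_iff_norm_sub_tendsto_zero.1 hvX).const_mul _).const_mul _)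
  simp only [zero_mul, mul_zero, add_zero] at h1
  refine squeeze_zero (fun _ => norm_nonneg _) (fun n => ?_) h1
  rw [mulL2_sub_mulL2 (hu n) hF (hv n) hX]
  exact (norm_add_le _ _).trans (add_le_add
    (norm_mulL2_le (Submodule.sub_mem _ (hu n) hF) (hv n))
    (norm_mulL2_le hF (Submodule.sub_mem _ (hv n) hX)))

lemma mulL2_mem_chaosLE {a b : ℕ} {F X : L2} (hF : F ∈ chaosLE a) (hX : X ∈ chaosLE b) :
    mulL2 F X ∈ chaosLE (a + b) := by
  obtain ⟨S, P, hP, hPF⟩ := exists_seq_of_mem_chaosLE hF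
  obtain ⟨T, Q, hQ, hQX⟩ := exists_seq_of_mem_chaosLE hX
  refine (isClosed_chaosLE (a + b)).mem_of_tendsto (tendsto_mulL2 hF hX
    (fun n => ofPoly_mem_chaosLE (hP n)) (fun n => ofPoly_mem_chaosLE (hQ n)) hPF hQX)
    (Eventually.of_forall fun n => ?_)
  rw [mulL2_ofPoly]
  exact ofPoly_mem_chaosLE (mul_mem_pchaosLE (pchaosLE_mono_left Finset.subset_union_left _ (hP n))
    (pchaosLE_mono_left (Finset.subset_union_right (s₁ := S n)) _ (hQ n)))

/-! ### Hermite polynomials of chaotic random variables -/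

lemma hermiteFun_succ_succ (j : ℕ) (x : ℝ) :
    hermiteFun (j + 2) x = x * hermiteFun (j + 1) x - (j + 1) * hermiteFun j x := by
  rw [hermiteFun, Polynomial.hermite_succ (j + 1), derivative_hermite_succ]
  simp [hermiteFun]

/-- The class of `H_k(F)` in `L2`. -/
def hermL2 (k : ℕ) (F : L2) : L2 := toL2 (hermiteOf k F)

/-- The class of the constant `1`. -/
def oneL2 : L2 := ofPoly 1

lemma coeFn_oneL2 : oneL2 =ᵐ[gaussianProd] fun _ => (1 : ℝ) :=
  (coeFn_ofPoly 1).trans (ae_of_all _ fun ω => by simp)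

lemma hermL2_zero (F : L2) : hermL2 0 F = oneL2 :=
  toL2_eq (coeFn_oneL2.trans (ae_of_all _ fun ω => by simp [hermiteOf, hermiteFun]))

lemma hermL2_one (F : L2) : hermL2 1 F = F :=
  toL2_eq (ae_of_all _ fun ω => by simp [hermiteOf, hermiteFun])

lemma oneL2_mem : oneL2 ∈ chaos 0 := ofPoly_mem_chaos (one_mem_pchaos ∅)

lemma chaosLE_mono {a b : ℕ} (h : a ≤ b) : chaosLE a ≤ chaosLE b :=
  iSup₂_le fun _ hm => chaos_le_chaosLE ((Nat.lt_succ_iff.1 (Finset.mem_range.1 hm)).trans h)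

lemma coeFn_hermite_recursion {a b : ℕ} {F : L2} (hF : F ∈ chaosLE a) {j : ℕ}
    (h : hermL2 (j + 1) F ∈ chaosLE b)
    (h1 : hermL2 (j + 1) F =ᵐ[gaussianProd] hermiteOf (j + 1) F)
    (h0 : hermL2 j F =ᵐ[gaussianProd] hermiteOf j F) :
    (mulL2 F (hermL2 (j + 1) F) - ((j : ℝ) + 1) • hermL2 j F : L2) =ᵐ[gaussianProd]
      hermiteOf (j + 2) F := by
  filter_upwards [Lp.coeFn_sub (mulL2 F (hermL2 (j + 1) F)) (((j : ℝ) + 1) • hermL2 j F),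
    Lp.coeFn_smul ((j : ℝ) + 1) (hermL2 j F), coeFn_mulL2 hF h, h1, h0] with ω e1 e2 e3 e4 e5
  rw [e1, Pi.sub_apply, e2, Pi.smul_apply, e3, e4, e5, hermiteOf, hermiteOf, hermiteOf,
    hermiteFun_succ_succ, smul_eq_mul]

lemma hermL2_mem_and_coeFn {p : ℕ} {F : L2} (hF : F ∈ chaosLE p) (k : ℕ) :
    hermL2 k F ∈ chaosLE (k * p) ∧ hermL2 k F =ᵐ[gaussianProd] hermiteOf k F := by
  induction k using Nat.twoStepInduction with
  | zero =>
    rw [hermL2_zero]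
    exact ⟨chaos_le_chaosLE (Nat.zero_le _) oneL2_mem,
      coeFn_oneL2.trans (ae_of_all _ fun ω => by simp [hermiteOf, hermiteFun])⟩
  | one =>
    rw [hermL2_one, one_mul]
    exact ⟨hF, ae_of_all _ fun ω => by simp [hermiteOf, hermiteFun]⟩
  | more j h0 h1 =>
    have hae := coeFn_hermite_recursion hF h1.1 h1.2 h0.2
    have e : hermL2 (j + 2) F = mulL2 F (hermL2 (j + 1) F) - ((j : ℝ) + 1) • hermL2 j F :=
      toL2_eq hae
    rw [e]
    refine ⟨Submodule.sub_mem _ ?_ (Submodule.smul_mem _ _ ?_), hae⟩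
    · exact chaosLE_mono (by ring_nf; omega) (mulL2_mem_chaosLE hF h1.1)
    · exact chaosLE_mono (Nat.mul_le_mul_right _ (by omega)) h0.1

lemma hermL2_mem {p : ℕ} {F : L2} (hF : F ∈ chaosLE p) (k : ℕ) : hermL2 k F ∈ chaosLE (k * p) :=
  (hermL2_mem_and_coeFn hF k).1

lemma coeFn_hermL2 {p : ℕ} {F : L2} (hF : F ∈ chaosLE p) (k : ℕ) :
    hermL2 k F =ᵐ[gaussianProd] hermiteOf k F :=
  (hermL2_mem_and_coeFn hF k).2

lemma hermL2_succ_succ {p : ℕ} {F : L2} (hF : F ∈ chaosLE p) (j : ℕ) :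
    hermL2 (j + 2) F = mulL2 F (hermL2 (j + 1) F) - ((j : ℝ) + 1) • hermL2 j F :=
  toL2_eq (coeFn_hermite_recursion hF (hermL2_mem hF (j + 1)) (coeFn_hermL2 hF (j + 1))
    (coeFn_hermL2 hF j))

lemma hermL2_ofPoly (k : ℕ) (P : Poly) :
    hermL2 k (ofPoly P) = ofPoly (Polynomial.aeval P (Polynomial.hermite k)) := by
  refine toL2_eq ?_
  filter_upwards [coeFn_ofPoly P, coeFn_ofPoly (Polynomial.aeval P (Polynomial.hermite k))]
    with ω h1 h2
  rw [h2, hermiteOf, h1, hermiteFun]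
  have h := Polynomial.aeval_algHom_apply ((MvPolynomial.aeval ω : Poly →ₐ[ℝ] ℝ).restrictScalars ℤ)
    P (Polynomial.hermite k)
  simp only [AlgHom.restrictScalars_apply, MvPolynomial.aeval_eq_eval] at h
  exact h.symm

lemma tendsto_hermL2 {p : ℕ} {F : L2} (hF : F ∈ chaosLE p) {u : ℕ → L2}
    (hu : ∀ n, u n ∈ chaosLE p) (huF : Tendsto u atTop (𝓝 F)) (k : ℕ) :
    Tendsto (fun n => hermL2 k (u n)) atTop (𝓝 (hermL2 k F)) := by
  induction k using Nat.twoStepInduction with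
  | zero => simpa only [hermL2_zero] using tendsto_const_nhds
  | one => simpa only [hermL2_one] using huF
  | more j h0 h1 =>
    rw [hermL2_succ_succ hF]
    simp_rw [fun n => hermL2_succ_succ (hu n) j]
    exact (tendsto_mulL2 hF (hermL2_mem hF _) hu (fun n => hermL2_mem (hu n) _) huF h1).sub
      (h0.const_smul _)

/-! ### The carré du champ of chaotic random variables -/

/-- The class in `L2` of `Γ[F,X]` for `F` and `X` in the chaoses of degree `p` and `q`, where
`L F = -pF` and `L X = -qX`. -/
def gamL2 (p q : ℕ) (F X : L2) : L2 :=
  (1 / 2 : ℝ) • (genLE (p + q) (mulL2 F X) + ((p : ℝ) + q) • mulL2 F X)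

lemma coeFn_gamL2 {p q : ℕ} {F X : L2} (hF : F ∈ chaos p) (hX : X ∈ chaos q) :
    gamL2 p q F X =ᵐ[gaussianProd] Gam F X := by
  have hF' := chaos_le_chaosLE le_rfl hF
  have hX' := chaos_le_chaosLE le_rfl hX
  filter_upwards [Lp.coeFn_smul (1 / 2 : ℝ)
      (genLE (p + q) (mulL2 F X) + ((p : ℝ) + q) • mulL2 F X),
    Lp.coeFn_add (genLE (p + q) (mulL2 F X)) (((p : ℝ) + q) • mulL2 F X),
    Lp.coeFn_smul ((p : ℝ) + q) (mulL2 F X), coeFn_mulL2 hF' hX', Lp.coeFn_smul (-(p : ℝ)) F,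
    Lp.coeFn_smul (-(q : ℝ)) X] with ω h1 h2 h3 h4 h5 h6
  rw [gamL2, h1, Pi.smul_apply, h2, Pi.add_apply, h3, Pi.smul_apply, h4, Gam, L_of_mem hF,
    L_of_mem hX, h5, h6, ← mulL2, L_eq_genLE (mulL2_mem_chaosLE hF' hX')]
  simp only [Pi.smul_apply, smul_eq_mul]
  ring

lemma gamL2_ofPoly {S : Finset ℕ} {p q : ℕ} {P Q : Poly} (hP : P ∈ pchaos S p)
    (hQ : Q ∈ pchaos S q) : gamL2 p q (ofPoly P) (ofPoly Q) = ofPoly (gam S P Q) := by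
  rw [gamL2, mulL2_ofPoly, genLE_ofPoly (mul_mem_pchaosLE (pchaos_le_pchaosLE le_rfl hP)
    (pchaos_le_pchaosLE le_rfl hQ)), ← map_smul, ← map_add, ← two_mul_gam hP hQ, ← map_smul]
  congr 1
  rw [MvPolynomial.smul_eq_C_mul, ← mul_assoc,
    show (2 : Poly) = MvPolynomial.C (2 : ℝ) by rw [map_ofNat], ← map_mul]
  norm_num

lemma tendsto_gamL2 {p q : ℕ} {F X : L2} (hF : F ∈ chaos p) (hX : X ∈ chaos q)
    {u v : ℕ → L2} (hu : ∀ n, u n ∈ chaos p) (hv : ∀ n, v n ∈ chaos q)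
    (huF : Tendsto u atTop (𝓝 F)) (hvX : Tendsto v atTop (𝓝 X)) :
    Tendsto (fun n => gamL2 p q (u n) (v n)) atTop (𝓝 (gamL2 p q F X)) := by
  have h := tendsto_mulL2 (chaos_le_chaosLE le_rfl hF) (chaos_le_chaosLE le_rfl hX)
    (fun n => chaos_le_chaosLE le_rfl (hu n)) (fun n => chaos_le_chaosLE le_rfl (hv n)) huF hvX
  exact ((((genLE (p + q)).continuous.tendsto _).comp h).add (h.const_smul _)).const_smul _

lemma eLpNorm_Gam {p q : ℕ} {F X : L2} (hF : F ∈ chaos p) (hX : X ∈ chaos q) :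
    eLpNorm (Gam F X) 2 gaussianProd = ENNReal.ofReal ‖gamL2 p q F X‖ := by
  rw [← eLpNorm_congr_ae (coeFn_gamL2 hF hX), ← Lp.enorm_def, ← ofReal_norm]

lemma inner_oneL2 (F : L2) : inner ℝ oneL2 F = ∫ ω, F ω ∂gaussianProd := by
  rw [L2.inner_def]
  refine integral_congr_ae ?_
  filter_upwards [coeFn_oneL2] with ω h
  rw [h]; simp

lemma norm_sq_eq_integral (F : L2) : ‖F‖ ^ 2 = ∫ ω, F ω ^ 2 ∂gaussianProd := by
  rw [← real_inner_self_eq_norm_sq, L2.inner_def]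
  refine integral_congr_ae (ae_of_all _ fun ω => ?_)
  simp [sq]

lemma norm_oneL2_sq : ‖oneL2‖ ^ 2 = 1 := by
  rw [oneL2, norm_ofPoly_sq]; simp

lemma variance_eq (F : L2) :
    variance F gaussianProd = ‖F - (inner ℝ oneL2 F : ℝ) • oneL2‖ ^ 2 := by
  rw [variance_eq_sub (Lp.memLp F), norm_sub_sq_real, norm_smul, mul_pow, norm_oneL2_sq,
    inner_smul_right, real_inner_comm oneL2 F, ← inner_oneL2, norm_sq_eq_integral]
  simp only [Pi.pow_apply, Real.norm_eq_abs, sq_abs]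
  ring

lemma variance_Gam {p q : ℕ} {F X : L2} (hF : F ∈ chaos p) (hX : X ∈ chaos q) :
    variance (Gam F X) gaussianProd = variance (gamL2 p q F X) gaussianProd :=
  variance_congr (coeFn_gamL2 hF hX).symm

/-! ### Inequalities for the carré du champ in the Wiener chaos -/

lemma variance_ofPoly (P : Poly) :
    variance (ofPoly P) gaussianProd = expect ((P - MvPolynomial.C (expect P)) ^ 2) := by
  rw [variance_eq, oneL2, inner_ofPoly, one_mul, ← map_smul, ← map_sub, norm_ofPoly_sq,
    MvPolynomial.smul_eq_C_mul, mul_one]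

lemma tendsto_variance {F : L2} {u : ℕ → L2} (h : Tendsto u atTop (𝓝 F)) :
    Tendsto (fun n => variance (u n) gaussianProd) atTop (𝓝 (variance F gaussianProd)) := by
  simp_rw [variance_eq]
  exact ((h.sub ((tendsto_const_nhds.inner h).smul_const _)).norm).pow 2

/-- The fourth moment bound on the variance of `Γ[F,F]`. -/
lemma variance_gamL2_le {p : ℕ} {F : L2} (hF : F ∈ chaos p) :
    variance (gamL2 p p F F) gaussianProd ≤
      p ^ 2 / 3 * (‖mulL2 F F‖ ^ 2 - 3 * (‖F‖ ^ 2) ^ 2) := by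
  obtain ⟨S, P, hP, hlim⟩ := exists_seq_of_mem_chaos hF
  have hm := fun n => ofPoly_mem_chaos (hP n)
  have hF' := chaos_le_chaosLE le_rfl hF
  have hm' := fun n => chaos_le_chaosLE le_rfl (hm n)
  refine le_of_tendsto_of_tendsto' (tendsto_variance (tendsto_gamL2 hF hF hm hm hlim hlim))
    ((((tendsto_mulL2 hF' hF' hm' hm' hlim hlim).norm.pow 2).sub
      (((hlim.norm.pow 2).pow 2).const_mul 3)).const_mul _) fun n => ?_
  rw [gamL2_ofPoly (hP n) (hP n), variance_ofPoly, expect_gam_self_of_mem (hP n), mulL2_ofPoly,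
    norm_ofPoly_sq, norm_ofPoly_sq, show (P n * P n) ^ 2 = P n ^ 4 by ring]
  exact expect_gam_sub_sq_le (hP n)

lemma inner_oneL2_gamL2 {p : ℕ} {F : L2} (hF : F ∈ chaos p) :
    inner ℝ oneL2 (gamL2 p p F F) = p * ‖F‖ ^ 2 := by
  obtain ⟨S, P, hP, hlim⟩ := exists_seq_of_mem_chaos hF
  have hm := fun n => ofPoly_mem_chaos (hP n)
  have h1 : Tendsto (fun n => inner ℝ oneL2 (gamL2 p p (ofPoly (P n)) (ofPoly (P n)))) atTop
      (𝓝 (inner ℝ oneL2 (gamL2 p p F F))) :=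
    tendsto_const_nhds.inner (tendsto_gamL2 hF hF hm hm hlim hlim)
  refine tendsto_nhds_unique h1 (((hlim.norm.pow 2).const_mul (p : ℝ)).congr fun n => ?_)
  rw [gamL2_ofPoly (hP n) (hP n), oneL2, inner_ofPoly, one_mul, expect_gam_self_of_mem (hP n),
    norm_ofPoly_sq]

/-- The distance of `Γ[F,F]` from the constant `p` splits into a variance and a bias. -/
lemma norm_gamL2_sub_sq {p : ℕ} {F : L2} (hF : F ∈ chaos p) :
    ‖gamL2 p p F F - (p : ℝ) • oneL2‖ ^ 2 =
      variance (gamL2 p p F F) gaussianProd + (p * (‖F‖ ^ 2 - 1)) ^ 2 := by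
  rw [variance_eq, norm_sub_sq_real, norm_sub_sq_real, norm_smul, norm_smul, mul_pow, mul_pow,
    norm_oneL2_sq, inner_smul_right, inner_smul_right, real_inner_comm oneL2, inner_oneL2_gamL2 hF,
    Real.norm_eq_abs, Real.norm_eq_abs, sq_abs, sq_abs]
  ring

lemma gamDev_eq {S : Finset ℕ} {p : ℕ} {P : Poly} (hP : P ∈ pchaos S p) :
    gamDev S p P = ‖gamL2 p p (ofPoly P) (ofPoly P) - (p : ℝ) • oneL2‖ := by
  rw [gamL2_ofPoly hP hP, oneL2, ← map_smul, ← map_sub, MvPolynomial.smul_eq_C_mul, mul_one,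
    ← Real.sqrt_sq (norm_nonneg _), norm_ofPoly_sq, gamDev]

lemma exists_norm_gamL2_sq_le (p q : ℕ) (hpq : q < p) : ∃ C : ℝ, 0 ≤ C ∧ ∀ F X : L2,
    F ∈ chaos p → X ∈ chaos q →
      ‖gamL2 p q F X‖ ^ 2 ≤ C * ‖gamL2 p p F F - (p : ℝ) • oneL2‖ * ‖X‖ ^ 2 := by
  obtain ⟨C, hC, h⟩ := exists_expect_gam_sq_le_gamDev p q hpq
  refine ⟨C, hC, fun F X hF hX => ?_⟩
  obtain ⟨S, P, hP, hPF⟩ := exists_seq_of_mem_chaos hF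
  obtain ⟨T, Q, hQ, hQX⟩ := exists_seq_of_mem_chaos hX
  have hP' := fun n => pchaos_mono (Finset.subset_union_left (s₂ := T n)) _ (hP n)
  have hQ' := fun n => pchaos_mono (Finset.subset_union_right (s₁ := S n)) _ (hQ n)
  have hm := fun n => ofPoly_mem_chaos (hP n)
  have hm' := fun n => ofPoly_mem_chaos (hQ n)
  refine le_of_tendsto_of_tendsto' ((tendsto_gamL2 hF hX hm hm' hPF hQX).norm.pow 2)
    ((((tendsto_gamL2 hF hF hm hm hPF hPF).sub_const _).norm.const_mul C).mul (hQX.norm.pow 2))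
    fun n => ?_
  rw [← gamDev_eq (hP' n), gamL2_ofPoly (hP' n) (hQ' n), norm_ofPoly_sq, norm_ofPoly_sq]
  exact h _ _ _ (hP' n) (hQ' n)

/-- The class of `(L + kp) H_k(F)`, for `F` in the chaos of degree `p`. -/
def ouHermL2 (p k : ℕ) (F : L2) : L2 :=
  genLE (k * p) (hermL2 k F) + ((k : ℝ) * (p : ℝ)) • hermL2 k F

lemma tendsto_ouHermL2 {p : ℕ} {F : L2} (hF : F ∈ chaosLE p) {u : ℕ → L2}
    (hu : ∀ n, u n ∈ chaosLE p) (huF : Tendsto u atTop (𝓝 F)) (k : ℕ) :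
    Tendsto (fun n => ouHermL2 p k (u n)) atTop (𝓝 (ouHermL2 p k F)) := by
  have h := tendsto_hermL2 hF hu huF k
  exact (((genLE (k * p)).continuous.tendsto _).comp h).add (h.const_smul _)

lemma ouHermL2_ofPoly {S : Finset ℕ} {p : ℕ} {P : Poly} (hP : P ∈ pchaos S p) (k : ℕ) :
    ouHermL2 p k (ofPoly P) = ofPoly (ouOp S (Polynomial.aeval P (Polynomial.hermite k)) +
      ((k : ℝ) * p) • Polynomial.aeval P (Polynomial.hermite k)) := by
  rw [ouHermL2, hermL2_ofPoly, genLE_ofPoly (aeval_hermite_mem hP k), map_add, map_smul]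

lemma exists_norm_ouHermL2_sq_le (p k : ℕ) (hk : 2 ≤ k) : ∃ C : ℝ, 0 ≤ C ∧ ∀ F : L2,
    F ∈ chaos p → ‖F‖ ^ 2 < 2 →
      ‖ouHermL2 p k F‖ ^ 2 ≤ C * ‖gamL2 p p F F - (p : ℝ) • oneL2‖ ^ 2 := by
  obtain ⟨C, hC, h⟩ := exists_expect_ouOp_hermite_le p k hk
  refine ⟨C, hC, fun F hF hF2 => ?_⟩
  obtain ⟨S, P, hP, hlim⟩ := exists_seq_of_mem_chaos hF
  have hm := fun n => ofPoly_mem_chaos (hP n)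
  have hm' := fun n => chaos_le_chaosLE le_rfl (hm n)
  refine le_of_tendsto_of_tendsto
    ((tendsto_ouHermL2 (chaos_le_chaosLE le_rfl hF) hm' hlim k).norm.pow 2)
    ((((tendsto_gamL2 hF hF hm hm hlim hlim).sub_const _).norm.pow 2).const_mul C) ?_
  filter_upwards [(hlim.norm.pow 2).eventually_lt_const hF2] with n hn
  rw [norm_ofPoly_sq] at hn
  rw [← gamDev_eq (hP n), ouHermL2_ofPoly (hP n), norm_ofPoly_sq, gamDev,
    Real.sq_sqrt (expect_sq_nonneg _)]
  exact h _ _ (hP n) hn.le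

lemma mulL2_zero_right {a : ℕ} {F : L2} (hF : F ∈ chaosLE a) : mulL2 F 0 = 0 := by
  have h := norm_mulL2_le hF (Submodule.zero_mem (chaosLE 0))
  rw [norm_zero, mul_zero, mul_zero] at h
  exact norm_le_zero_iff.1 h

lemma gamL2_sub_left {p q : ℕ} {F F' X : L2} (hF : F ∈ chaos p) (hF' : F' ∈ chaos p)
    (hX : X ∈ chaos q) : gamL2 p q F X - gamL2 p q F' X = gamL2 p q (F - F') X := by
  have h := mulL2_sub_mulL2 (chaos_le_chaosLE le_rfl hF) (chaos_le_chaosLE le_rfl hF')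
    (chaos_le_chaosLE le_rfl hX) (chaos_le_chaosLE le_rfl hX)
  rw [sub_self, mulL2_zero_right (chaos_le_chaosLE le_rfl hF'), add_zero] at h
  rw [gamL2, gamL2, gamL2, ← h, map_sub]
  module

lemma gamL2_smul_right {p q : ℕ} {F X : L2} (hF : F ∈ chaos p) (hX : X ∈ chaos q) (c : ℝ) :
    gamL2 p q F (c • X) = c • gamL2 p q F X := by
  have h : mulL2 F (c • X) = c • mulL2 F X := by
    refine toL2_eq ?_
    filter_upwards [Lp.coeFn_smul c (mulL2 F X), Lp.coeFn_smul c X,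
      coeFn_mulL2 (chaos_le_chaosLE le_rfl hF) (chaos_le_chaosLE le_rfl hX)] with ω h1 h2 h3
    rw [h1, h2, Pi.smul_apply, Pi.smul_apply, h3, smul_eq_mul, smul_eq_mul]
    ring
  rw [gamL2, gamL2, h, map_smul]
  module

/-- A bound for the norm of `(F, X) ↦ Γ[F,X]` on the chaoses of degree `p` and `q`. -/
def gamConst (p q : ℕ) : ℝ := 1 / 2 * ((‖genLE (p + q)‖ + (p + q)) * mulConst p q)

lemma norm_gamL2_le {p q : ℕ} {F X : L2} (hF : F ∈ chaos p) (hX : X ∈ chaos q) :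
    ‖gamL2 p q F X‖ ≤ gamConst p q * ‖F‖ * ‖X‖ := by
  have h := norm_mulL2_le (chaos_le_chaosLE le_rfl hF) (chaos_le_chaosLE le_rfl hX)
  have h1 : ‖genLE (p + q) (mulL2 F X) + ((p : ℝ) + q) • mulL2 F X‖ ≤
      (‖genLE (p + q)‖ + (p + q)) * ‖mulL2 F X‖ := by
    refine (norm_add_le _ _).trans ?_
    rw [add_mul, norm_smul, Real.norm_of_nonneg (by positivity)]
    exact add_le_add ((genLE (p + q)).le_opNorm _) le_rfl
  rw [gamL2, norm_smul, Real.norm_of_nonneg (by norm_num), gamConst]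
  have h2 := mul_le_mul_of_nonneg_left h
    (by positivity : 0 ≤ ‖genLE (p + q)‖ + ((p : ℝ) + q))
  linarith

/-- A uniform bound on `Γ[F,·]` on the chaos of a degree `q ≥ ⌊p/2⌋` bounds the variance of
`Γ[F,F]`. -/
lemma exists_variance_gamL2_le (p q : ℕ) (hp : 1 ≤ p) (hq : p / 2 ≤ q) : ∃ C : ℝ, 0 ≤ C ∧
    ∀ (F : L2) (r : ℝ), F ∈ chaos p → 0 ≤ r → (∀ X ∈ chaos q, ‖gamL2 p q F X‖ ≤ r * ‖X‖) →
      variance (gamL2 p p F F) gaussianProd ≤ C * (r ^ 2 * ‖F‖ ^ 2) := by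
  refine ⟨4 * 5 ^ (2 * p) * ((p : ℝ) ^ 2 * ((p : ℝ) ^ p * (p : ℝ) ^ p)), by positivity,
    fun F r hF hr h => ?_⟩
  obtain ⟨S, P, hP, hlim⟩ := exists_seq_of_mem_chaos hF
  have hm := fun n => ofPoly_mem_chaos (hP n)
  have hK : 0 ≤ gamConst p q := by
    have := mulConst_nonneg p q
    rw [gamConst]; positivity
  -- By linearity in `F`, the approximation `P n` has influence at most
  -- `r + gamConst p q * ‖ofPoly (P n) - F‖`.
  have hr' : Tendsto (fun n => (r + gamConst p q * ‖ofPoly (P n) - F‖) ^ 2) atTop (𝓝 (r ^ 2)) := by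
    have := (((tendsto_iff_norm_sub_tendsto_zero.1 hlim).const_mul
      (gamConst p q)).const_add r).pow 2
    simpa using this
  refine le_of_tendsto_of_tendsto' (tendsto_variance (tendsto_gamL2 hF hF hm hm hlim hlim))
    ((hr'.mul (hlim.norm.pow 2)).const_mul _) fun n => ?_
  rw [gamL2_ofPoly (hP n) (hP n), variance_ofPoly, expect_gam_self_of_mem (hP n), norm_ofPoly_sq]
  refine InfluenceSqLE.expect_gam_sub_sq_le (q := q) hp (by positivity) (hP n) ?_ hq
  intro T hT X hX
  have hPT := pchaos_mono hT p (hP n)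
  have hXm := ofPoly_mem_chaos hX
  rw [← norm_ofPoly_sq, ← norm_ofPoly_sq, ← gamL2_ofPoly hPT hX, ← mul_pow]
  refine pow_le_pow_left₀ (norm_nonneg _) ?_ 2
  have e := gamL2_sub_left (hm n) hF hXm
  rw [sub_eq_iff_eq_add] at e
  rw [e]
  have h1 := norm_gamL2_le (Submodule.sub_mem _ (hm n) hF) hXm
  have h2 := h _ hXm
  refine (norm_add_le _ _).trans ?_
  linarith

/-! ### The method of moments for the Gaussian distribution -/

/-- The Taylor remainder of the exponential on the imaginary axis. -/
lemma norm_cexp_mul_I_sub_sum_le (t : ℝ) (n : ℕ) :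
    ‖Complex.exp (t * Complex.I) - ∑ k ∈ Finset.range n, (t * Complex.I) ^ k / (k.factorial : ℂ)‖ ≤
      |t| ^ n / n.factorial := by
  set a : ℂ := t * Complex.I with ha
  have hna : ‖a‖ = |t| := by simp [ha]
  -- The remainder at time `x` along the ray through `a` is bounded by integrating its derivative,
  -- which is `a` times the remainder of the previous order.
  have key : ∀ n : ℕ, ∀ x ∈ Set.Icc (0 : ℝ) 1,
      ‖Complex.exp (a * x) - ∑ k ∈ Finset.range n, (a * x) ^ k / (k.factorial : ℂ)‖ ≤
        |t| ^ n * x ^ n / n.factorial := by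
    intro n
    induction n with
    | zero =>
      intro x _
      have : a * x = ((t * x : ℝ) : ℂ) * Complex.I := by rw [ha]; push_cast; ring
      simp only [Finset.range_zero, Finset.sum_empty, sub_zero, this, Complex.norm_exp_ofReal_mul_I]
      simp
    | succ n ih =>
      have hd : ∀ x : ℝ, HasDerivAt (fun x : ℝ => Complex.exp (a * x) -
          ∑ k ∈ Finset.range (n + 1), (a * x) ^ k / (k.factorial : ℂ))
          (a * (Complex.exp (a * x) -
            ∑ k ∈ Finset.range n, (a * x) ^ k / (k.factorial : ℂ))) x := by
        intro x
        have h0 : HasDerivAt (fun x : ℝ => a * (x : ℂ)) a x := by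
          simpa using (Complex.ofRealCLM.hasDerivAt (x := x)).const_mul a
        have h1 : ∀ k ∈ Finset.range n, HasDerivAt
            (fun x : ℝ => (a * (x : ℂ)) ^ (k + 1) / ((k + 1).factorial : ℂ))
            (a * ((a * x) ^ k / (k.factorial : ℂ))) x := by
          intro k _
          refine ((h0.pow (k + 1)).div_const _).congr_deriv ?_
          have h2 : (k.factorial : ℂ) ≠ 0 := by exact_mod_cast k.factorial_ne_zero
          have h3 : (k : ℂ) + 1 ≠ 0 := by exact_mod_cast k.succ_ne_zero
          rw [Nat.factorial_succ]
          push_cast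
          field_simp
        have h4 := h0.cexp.sub ((HasDerivAt.fun_sum h1).add_const (1 : ℂ))
        refine (h4.congr_deriv ?_).congr_of_eventuallyEq (Eventually.of_forall fun y => ?_)
        · rw [← Finset.mul_sum]; ring
        · simp [Finset.sum_range_succ' _ n]
      have hB : ∀ x : ℝ, HasDerivAt (fun x : ℝ => |t| ^ (n + 1) * x ^ (n + 1) / (n + 1).factorial)
          (|t| * (|t| ^ n * x ^ n / n.factorial)) x := by
        intro x
        refine (((hasDerivAt_pow (n + 1) x).const_mul _).div_const _).congr_deriv ?_
        have h2 : (n.factorial : ℝ) ≠ 0 := by exact_mod_cast n.factorial_ne_zero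
        have h3 : (n : ℝ) + 1 ≠ 0 := by exact_mod_cast n.succ_ne_zero
        rw [Nat.factorial_succ]
        push_cast
        field_simp
        ring
      intro x hx
      refine image_norm_le_of_norm_deriv_right_le_deriv_boundary
        (fun y _ => (hd y).continuousAt.continuousWithinAt) (fun y _ => (hd y).hasDerivWithinAt)
        ?_ hB (fun y hy => ?_) hx
      · simp [Finset.sum_range_succ' _ n]
      · rw [norm_mul, hna]
        exact mul_le_mul_of_nonneg_left (ih y ⟨hy.1, hy.2.le⟩) (abs_nonneg _)
  simpa using key n 1 ⟨zero_le_one, le_rfl⟩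

/-- The truncated moment expansion of a characteristic function. -/
lemma norm_charFun_sub_sum_le (ν : Measure ℝ) [IsProbabilityMeasure ν]
    (h : ∀ k : ℕ, Integrable (fun x : ℝ => x ^ k) ν) (t : ℝ) (K : ℕ) :
    ‖charFun ν t - ∑ k ∈ Finset.range (2 * K),
        (t * Complex.I) ^ k / (k.factorial : ℂ) * ((∫ x, x ^ k ∂ν : ℝ) : ℂ)‖ ≤
      t ^ (2 * K) / (2 * K).factorial * ∫ x, x ^ (2 * K) ∂ν := by
  have hi : ∀ k : ℕ, Integrable (fun x : ℝ => (t * Complex.I) ^ k / (k.factorial : ℂ) *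
      ((x ^ k : ℝ) : ℂ)) ν := fun k => (h k).ofReal.const_mul _
  have e1 : ∑ k ∈ Finset.range (2 * K), (t * Complex.I) ^ k / (k.factorial : ℂ) *
      ((∫ x, x ^ k ∂ν : ℝ) : ℂ) = ∫ x, ∑ k ∈ Finset.range (2 * K),
        (t * Complex.I) ^ k / (k.factorial : ℂ) * ((x ^ k : ℝ) : ℂ) ∂ν := by
    rw [integral_finsetSum _ fun k _ => hi k]
    refine Finset.sum_congr rfl fun k _ => ?_
    rw [integral_const_mul, integral_complex_ofReal]
  have hexp : Integrable (fun x : ℝ => Complex.exp (t * x * Complex.I)) ν := by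
    refine Integrable.of_bound (C := 1) (by fun_prop) (ae_of_all _ fun x => ?_)
    rw [← Complex.ofReal_mul, Complex.norm_exp_ofReal_mul_I]
  rw [charFun_apply_real, e1, ← integral_sub hexp (integrable_finsetSum _ fun k _ => hi k),
    ← integral_const_mul]
  refine norm_integral_le_of_norm_le ((h _).const_mul _) (ae_of_all _ fun x => ?_)
  have h1 := norm_cexp_mul_I_sub_sum_le (t * x) (2 * K)
  rw [pow_mul |t * x|, sq_abs, ← pow_mul] at h1
  refine le_trans (le_of_eq ?_) (h1.trans (le_of_eq ?_))
  · congr 2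
    · push_cast; rfl
    · refine Finset.sum_congr rfl fun k _ => ?_
      push_cast
      rw [mul_pow, mul_pow, mul_pow]; ring
  · rw [mul_pow]; ring

lemma pow_mul_moment_div_factorial (t : ℝ) (K : ℕ) :
    t ^ (2 * K) / (2 * K).factorial * ∫ x, x ^ (2 * K) ∂gaussianReal 0 1 =
      (t ^ 2 / 2) ^ K / K.factorial := by
  induction K with
  | zero => simp
  | succ K ih =>
    rw [show 2 * (K + 1) = 2 * K + 1 + 1 by ring, integral_pow_succ_gaussianReal,
      show 2 * K + 1 - 1 = 2 * K by omega, pow_succ (t ^ 2 / 2), Nat.factorial_succ (2 * K + 1),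
      Nat.factorial_succ (2 * K), Nat.factorial_succ K]
    have h1 : ((2 * K).factorial : ℝ) ≠ 0 := by exact_mod_cast (2 * K).factorial_ne_zero
    have h2 : (K.factorial : ℝ) ≠ 0 := by exact_mod_cast K.factorial_ne_zero
    rw [div_mul_eq_mul_div, div_eq_div_iff h1 h2] at ih
    push_cast
    have h3 : (2 * (K : ℝ) + 1 + 1) ≠ 0 := by positivity
    have h4 : (2 * (K : ℝ) + 1) ≠ 0 := by positivity
    have h5 : ((K : ℝ) + 1) ≠ 0 := by positivity
    rw [div_mul_eq_mul_div, div_eq_div_iff (by positivity) (by positivity)]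
    linear_combination (t ^ 2 * (2 * (K : ℝ) + 1) * (K + 1)) * ih

/-- If all moments converge to the Gaussian moments, so do the characteristic functions. -/
lemma tendsto_charFun_of_moments (ν : ℕ → Measure ℝ) [∀ n, IsProbabilityMeasure (ν n)]
    (h : ∀ n k, Integrable (fun x : ℝ => x ^ k) (ν n))
    (hlim : ∀ k : ℕ, Tendsto (fun n => ∫ x, x ^ k ∂ν n) atTop
      (𝓝 (∫ x, x ^ k ∂gaussianReal 0 1))) (t : ℝ) :
    Tendsto (fun n => charFun (ν n) t) atTop (𝓝 (charFun (gaussianReal 0 1) t)) := by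
  rw [Metric.tendsto_atTop']
  intro ε hε
  have hK := (FloorSemiring.tendsto_pow_div_factorial_atTop (t ^ 2 / 2)).eventually_lt_const
    (by positivity : 0 < ε / 4)
  obtain ⟨K, hK⟩ := hK.exists
  rw [← pow_mul_moment_div_factorial] at hK
  have h1 := ((hlim (2 * K)).const_mul (t ^ (2 * K) / (2 * K).factorial)).eventually_lt_const hK
  have h2 : Tendsto (fun n => ∑ k ∈ Finset.range (2 * K),
      (t * Complex.I) ^ k / (k.factorial : ℂ) * ((∫ x, x ^ k ∂ν n : ℝ) : ℂ)) atTop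
      (𝓝 (∑ k ∈ Finset.range (2 * K), (t * Complex.I) ^ k / (k.factorial : ℂ) *
        ((∫ x, x ^ k ∂gaussianReal 0 1 : ℝ) : ℂ))) :=
    tendsto_finsetSum _ fun k _ =>
      ((Complex.continuous_ofReal.tendsto _).comp (hlim k)).const_mul _
  have h3 := (Metric.tendsto_nhds.1 h2) (ε / 4) (by positivity)
  obtain ⟨N, hN⟩ := eventually_atTop.1 (h1.and h3)
  refine ⟨N, fun n hn => ?_⟩
  obtain ⟨h1, h3⟩ := hN n hn.le
  have h4 := norm_charFun_sub_sum_le (ν n) (h n) t K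
  have h5 := norm_charFun_sub_sum_le (gaussianReal 0 1) integrable_pow_gaussianReal t K
  rw [← dist_eq_norm] at h4 h5
  have h6 := dist_triangle4 (charFun (ν n) t) (∑ k ∈ Finset.range (2 * K),
      (t * Complex.I) ^ k / (k.factorial : ℂ) * ((∫ x, x ^ k ∂ν n : ℝ) : ℂ))
    (∑ k ∈ Finset.range (2 * K), (t * Complex.I) ^ k / (k.factorial : ℂ) *
      ((∫ x, x ^ k ∂gaussianReal 0 1 : ℝ) : ℂ)) (charFun (gaussianReal 0 1) t)
  rw [dist_comm] at h5
  linarith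

/-- The Hermite polynomials span all polynomials. -/
lemma eq_top_of_hermite_mem (V : Submodule ℝ (Polynomial ℝ))
    (h : ∀ k, (Polynomial.hermite k).map (Int.castRingHom ℝ) ∈ V) : V = ⊤ := by
  have hX : ∀ k : ℕ, (Polynomial.X : Polynomial ℝ) ^ k ∈ V := by
    intro k
    induction k using Nat.strong_induction_on with
    | _ k ih =>
    have hm : ((Polynomial.hermite k).map (Int.castRingHom ℝ)).Monic :=
      (Polynomial.hermite_monic k).map _
    have hd : ((Polynomial.hermite k).map (Int.castRingHom ℝ)).natDegree = k := by
      rw [(Polynomial.hermite_monic k).natDegree_map, Polynomial.natDegree_hermite]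
    have e := hm.as_sum
    rw [hd] at e
    rw [← sub_eq_iff_eq_add] at e
    rw [← e]
    refine Submodule.sub_mem _ (h k) (Submodule.sum_mem _ fun i hi => ?_)
    rw [← Polynomial.smul_eq_C_mul]
    exact Submodule.smul_mem _ _ (ih i (Finset.mem_range.1 hi))
  rw [eq_top_iff]
  intro f _
  rw [f.as_sum_range_C_mul_X_pow]
  refine Submodule.sum_mem _ fun k _ => ?_
  rw [← Polynomial.smul_eq_C_mul]
  exact Submodule.smul_mem _ _ (hX k)

lemma hermiteFun_eq_eval (k : ℕ) (x : ℝ) :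
    hermiteFun k x = ((Polynomial.hermite k).map (Int.castRingHom ℝ)).eval x := by
  rw [hermiteFun, Polynomial.aeval_def, Polynomial.eval₂_eq_eval_map]
  rfl

lemma continuous_hermiteFun (k : ℕ) : Continuous (hermiteFun k) := by
  simp_rw [funext (hermiteFun_eq_eval k)]
  exact Polynomial.continuous _

lemma map_coord_gaussianProd : gaussianProd.map (fun ω : Space => ω 0) = gaussianReal 0 1 :=
  Measure.infinitePi_map_eval _ 0

lemma integrable_hermiteFun (k : ℕ) : Integrable (hermiteFun k) (gaussianReal 0 1) := by
  rw [← map_coord_gaussianProd, integrable_map_measure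
    (continuous_hermiteFun k).aestronglyMeasurable (measurable_pi_apply 0).aemeasurable]
  refine (integrable_eval (herm (Finsupp.single 0 k))).congr (ae_of_all _ fun ω => ?_)
  simp [eval_herm, hermiteProd, hermiteFun]

lemma integral_hermiteFun {k : ℕ} (hk : k ≠ 0) : ∫ x, hermiteFun k x ∂gaussianReal 0 1 = 0 := by
  rw [← map_coord_gaussianProd, integral_map (measurable_pi_apply 0).aemeasurable
    (continuous_hermiteFun k).aestronglyMeasurable]
  have h := expect_eq_zero (S := {0}) (p := k) hk (P := herm (Finsupp.single 0 k)) (by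
    have h := herm_mem_pchaos (S := {0}) (k := Finsupp.single 0 k) Finsupp.support_single_subset
    simpa using h)
  rw [← h, expect_eq_integral]
  refine integral_congr_ae (ae_of_all _ fun ω => ?_)
  simp [eval_herm, hermiteProd, hermiteFun]

/-- Convergence of the Hermite expectations is inherited by all polynomials, which are their
linear combinations. -/
lemma moments_of_hermite (ν : ℕ → Measure ℝ)
    (hint : ∀ n k, Integrable (hermiteFun k) (ν n))
    (hlim : ∀ k : ℕ, Tendsto (fun n => ∫ x, hermiteFun k x ∂ν n) atTop
      (𝓝 (∫ x, hermiteFun k x ∂gaussianReal 0 1))) (k : ℕ) :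
    (∀ n, Integrable (fun x : ℝ => x ^ k) (ν n)) ∧ Tendsto (fun n => ∫ x, x ^ k ∂ν n) atTop
      (𝓝 (∫ x, x ^ k ∂gaussianReal 0 1)) := by
  -- The polynomials whose expectations exist and converge.
  let V : Submodule ℝ (Polynomial ℝ) :=
    { carrier := {f | (∀ n, Integrable (fun x => f.eval x) (ν n)) ∧
        Integrable (fun x => f.eval x) (gaussianReal 0 1) ∧
        Tendsto (fun n => ∫ x, f.eval x ∂ν n) atTop (𝓝 (∫ x, f.eval x ∂gaussianReal 0 1))}
      add_mem' := by
        rintro f g ⟨hf1, hf2, hf3⟩ ⟨hg1, hg2, hg3⟩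
        simp only [Set.mem_ofPred_eq, Polynomial.eval_add]
        refine ⟨fun n => (hf1 n).add (hg1 n), hf2.add hg2, ?_⟩
        rw [integral_add hf2 hg2]
        simp_rw [fun n => integral_add (hf1 n) (hg1 n)]
        exact hf3.add hg3
      zero_mem' := by simp
      smul_mem' := by
        rintro c f ⟨hf1, hf2, hf3⟩
        simp only [Set.mem_ofPred_eq, Polynomial.eval_smul, smul_eq_mul, integral_const_mul]
        exact ⟨fun n => (hf1 n).const_mul c, hf2.const_mul c, hf3.const_mul c⟩ }
  have hV : V = ⊤ := eq_top_of_hermite_mem V fun k => by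
    refine ⟨fun n => ?_, ?_, ?_⟩
    · exact (hint n k).congr (ae_of_all _ fun x => hermiteFun_eq_eval k x)
    · exact (integrable_hermiteFun k).congr (ae_of_all _ fun x => hermiteFun_eq_eval k x)
    · simpa only [hermiteFun_eq_eval] using hlim k
  have hk : (Polynomial.X ^ k : Polynomial ℝ) ∈ V := hV ▸ Submodule.mem_top
  obtain ⟨h1, -, h2⟩ := hk
  exact ⟨by simpa using h1, by simpa using h2⟩

/-- A sequence of random variables whose Hermite expectations tend to zero is asymptotically
Gaussian. -/
lemma tendstoInDistribution_of_hermite {F : ℕ → L2}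
    (hint : ∀ n k, Integrable (hermiteOf k (F n)) gaussianProd)
    (hlim : ∀ k : ℕ, k ≠ 0 →
      Tendsto (fun n => ∫ ω, hermiteOf k (F n) ω ∂gaussianProd) atTop (𝓝 0)) :
    TendstoInDistribution (fun n ω => F n ω) atTop (id : ℝ → ℝ)
        (fun _ => gaussianProd) (gaussianReal 0 1) := by
  have hF : ∀ n, AEMeasurable (F n) gaussianProd :=
    fun n => (Lp.aestronglyMeasurable _).aemeasurable
  have hprob : ∀ n, IsProbabilityMeasure (gaussianProd.map (F n)) := fun n =>
    Measure.isProbabilityMeasure_map (hF n)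
  have hm := moments_of_hermite (fun n => gaussianProd.map (F n))
    (fun n k => (integrable_map_measure (continuous_hermiteFun k).aestronglyMeasurable (hF n)).2
      (hint n k))
    (fun k => by
      simp_rw [fun n => integral_map (hF n) (continuous_hermiteFun k).aestronglyMeasurable]
      by_cases hk : k = 0
      · subst hk
        simp [hermiteFun]
      · rw [integral_hermiteFun hk]
        exact hlim k hk)
  refine ⟨hF, by fun_prop, ProbabilityMeasure.tendsto_iff_tendsto_charFun.2 fun t => ?_⟩
  have h := tendsto_charFun_of_moments (fun n => gaussianProd.map (F n)) (fun n k => (hm k).1 n)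
    (fun k => (hm k).2) t
  simpa using h

/-! ### Fourth moments of asymptotically Gaussian sequences -/

lemma integral_pow_four_gaussianReal : ∫ x, x ^ 4 ∂gaussianReal 0 1 = 3 := by
  have h1 := integral_pow_succ_gaussianReal 3
  have h2 := integral_pow_succ_gaussianReal 1
  norm_num at h1 h2
  rw [h1, h2]; norm_num

/-- The fourth moment is bounded by a truncated fourth moment, up to an error controlled by the
eighth moment, which hypercontractivity bounds by the second moment. -/
lemma norm_mulL2_self_sq_le {a : ℕ} {F : L2} (hF : F ∈ chaosLE a) {M : ℝ} (hM : 0 < M) :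
    ‖mulL2 F F‖ ^ 2 ≤ ∫ ω, min (F ω ^ 4) M ∂gaussianProd +
      (mulConst (a + a) (a + a) * (mulConst a a * ‖F‖ ^ 2) ^ 2) ^ 2 / M := by
  have hY := mulL2_mem_chaosLE hF hF
  have hae := coeFn_mulL2 hF hF
  have hae2 := coeFn_mulL2 hY hY
  have h1 : Integrable (fun ω => mulL2 F F ω ^ 2) gaussianProd := (Lp.memLp _).integrable_sq
  have h2 : Integrable (fun ω => mulL2 (mulL2 F F) (mulL2 F F) ω ^ 2) gaussianProd :=
    (Lp.memLp _).integrable_sq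
  have h3 : Integrable (fun ω => min (F ω ^ 4) M) gaussianProd := by
    refine Integrable.of_bound (C := M) ?_ (ae_of_all _ fun ω => ?_)
    · exact (((Lp.aestronglyMeasurable F).aemeasurable.pow_const 4).min
        aemeasurable_const).aestronglyMeasurable
    · rw [Real.norm_of_nonneg (le_min (by positivity) hM.le)]
      exact min_le_right _ _
  have h4 : ‖mulL2 F F‖ ^ 2 ≤ ∫ ω, min (F ω ^ 4) M ∂gaussianProd +
      ‖mulL2 (mulL2 F F) (mulL2 F F)‖ ^ 2 / M := by
    rw [norm_sq_eq_integral, norm_sq_eq_integral, ← integral_div,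
      ← integral_add h3 (h2.div_const M)]
    refine integral_mono_ae h1 (h3.add (h2.div_const M)) ?_
    filter_upwards [hae, hae2] with ω e1 e2
    simp only [e2, e1]
    set z := F ω ^ 4 with hz
    have hz0 : 0 ≤ z := by positivity
    have e3 : (F ω * F ω) ^ 2 = z := by rw [hz]; ring
    have e4 : (F ω * F ω * (F ω * F ω)) ^ 2 = z ^ 2 := by rw [hz]; ring
    rw [e3, e4]
    rcases le_total z M with h | h
    · rw [min_eq_left h]
      exact le_add_of_nonneg_right (by positivity)
    · have : z ≤ z ^ 2 / M := by rw [le_div_iff₀ hM]; nlinarith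
      exact this.trans (le_add_of_nonneg_left (le_min hz0 hM.le))
  refine h4.trans (add_le_add le_rfl (div_le_div_of_nonneg_right ?_ hM.le))
  refine pow_le_pow_left₀ (norm_nonneg _) ((norm_mulL2_le hY hY).trans ?_) 2
  rw [← sq]
  refine mul_le_mul_of_nonneg_left (pow_le_pow_left₀ (norm_nonneg _) ?_ 2) (mulConst_nonneg _ _)
  rw [sq ‖F‖]
  exact norm_mulL2_le hF hF

/-- Asymptotically Gaussian sequences in a fixed chaos have asymptotic fourth moment at most `3`. -/
lemma eventually_norm_mulL2_lt {p : ℕ} {F : ℕ → L2} (hF : ∀ n, F n ∈ chaosLE p)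
    (hnorm : Tendsto (fun n => ‖F n‖ ^ 2) atTop (𝓝 1))
    (h : TendstoInDistribution (fun n ω => F n ω) atTop (id : ℝ → ℝ)
      (fun _ => gaussianProd) (gaussianReal 0 1)) {ε : ℝ} (hε : 0 < ε) :
    ∀ᶠ n in atTop, ‖mulL2 (F n) (F n)‖ ^ 2 < 3 + ε := by
  set B := (mulConst (p + p) (p + p) * (mulConst p p * 2) ^ 2) ^ 2 with hB
  have hB0 : 0 ≤ B := sq_nonneg _
  -- A truncation level which makes the error term smaller than `ε / 2`.
  obtain ⟨M, hM, hBM⟩ : ∃ M : ℝ, 0 < M ∧ B / M < ε / 2 := by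
    refine ⟨2 * (B + 1) / ε, by positivity, ?_⟩
    rw [div_lt_iff₀ (by positivity)]
    field_simp
    linarith
  let g : BoundedContinuousFunction ℝ ℝ := BoundedContinuousFunction.ofNormedAddCommGroup
    (fun x => min (x ^ 4) M) (by fun_prop) M fun x => by
      rw [Real.norm_of_nonneg (le_min (by positivity) hM.le)]
      exact min_le_right _ _
  have hmeas : ∀ n, AEMeasurable (F n) gaussianProd :=
    fun n => (Lp.aestronglyMeasurable _).aemeasurable
  have h1 := (ProbabilityMeasure.tendsto_iff_forall_integral_tendsto.1 h.tendsto) g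
  have h2 : ∫ x, g x ∂gaussianReal 0 1 ≤ 3 := by
    rw [← integral_pow_four_gaussianReal]
    exact integral_mono (g.integrable _) (integrable_pow_gaussianReal 4) fun x => min_le_left _ _
  have h3 : Tendsto (fun n => ∫ ω, min (F n ω ^ 4) M ∂gaussianProd) atTop
      (𝓝 (∫ x, g x ∂gaussianReal 0 1)) := by
    simp only [ProbabilityMeasure.coe_mk, Measure.map_id] at h1
    refine h1.congr fun n => ?_
    rw [integral_map (hmeas n) g.continuous.aestronglyMeasurable]
    rfl
  filter_upwards [h3.eventually_lt_const (by linarith : _ < 3 + ε / 2),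
    hnorm.eventually_lt_const (by norm_num : (1 : ℝ) < 2)] with n hn1 hn2
  refine (norm_mulL2_self_sq_le (hF n) hM).trans_lt ?_
  have h4 : (mulConst (p + p) (p + p) * (mulConst p p * ‖F n‖ ^ 2) ^ 2) ^ 2 ≤ B := by
    have := mulConst_nonneg p p
    have := mulConst_nonneg (p + p) (p + p)
    rw [hB]
    gcongr
  have h5 := div_le_div_of_nonneg_right h4 hM.le
  linarith

/-! ### Components of the generator and influences -/

lemma J_genLE {q d : ℕ} (hq : q ≤ d) (F : L2) : J q (genLE d F) = (-(q : ℝ)) • J q F := by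
  rw [genLE, _root_.sum_apply, map_sum, Finset.sum_eq_single q]
  · rw [_root_.smul_apply, map_smul, J_of_mem (J_mem q F)]
  · intro m _ hm
    rw [_root_.smul_apply, map_smul, J_of_mem_of_ne hm (J_mem m F), smul_zero]
  · intro h
    exact absurd (Finset.mem_range.2 (Nat.lt_succ_of_le hq)) h

lemma J_ouHermL2 {p k q : ℕ} (hq : q ≤ k * p) (F : L2) :
    J q (ouHermL2 p k F) = ((k : ℝ) * p - q) • J q (hermL2 k F) := by
  rw [ouHermL2, map_add, J_genLE hq, map_smul]
  module

lemma influence_le {p q : ℕ} {F : L2} (hF : F ∈ chaos p) {r : ℝ}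
    (h : ∀ X ∈ chaos q, ‖X‖ = 1 → ‖gamL2 p q F X‖ ≤ r) :
    influence q F ≤ ENNReal.ofReal r := by
  refine iSup_le fun X => iSup_le fun hX => iSup_le fun h1 => ?_
  rw [eLpNorm_Gam hF hX]
  exact ENNReal.ofReal_le_ofReal (h X hX h1)

/-- A finite influence bounds `X ↦ Γ[F,X]`. Finiteness is needed as `∞.toReal = 0`. -/
lemma norm_gamL2_le_influence {p q : ℕ} {F : L2} (hF : F ∈ chaos p) (hfin : influence q F ≠ ∞)
    {X : L2} (hX : X ∈ chaos q) : ‖gamL2 p q F X‖ ≤ (influence q F).toReal * ‖X‖ := by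
  have hunit : ∀ Y ∈ chaos q, ‖Y‖ = 1 → ‖gamL2 p q F Y‖ ≤ (influence q F).toReal := by
    intro Y hY h1
    rw [← ENNReal.ofReal_le_iff_le_toReal hfin, ← eLpNorm_Gam hF hY]
    exact le_iSup_of_le Y (le_iSup_of_le hY (le_iSup_of_le h1 le_rfl))
  by_cases h0 : ‖X‖ = 0
  · rw [norm_eq_zero.1 h0]
    have := norm_gamL2_le hF (Submodule.zero_mem (chaos q))
    simpa using this
  · have h1 := hunit _ (Submodule.smul_mem _ (‖X‖⁻¹) hX) (by
      rw [norm_smul, norm_inv, norm_norm, inv_mul_cancel₀ h0])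
    rw [gamL2_smul_right hF hX, norm_smul, norm_inv, norm_norm] at h1
    rwa [inv_mul_le_iff₀ (lt_of_le_of_ne (norm_nonneg _) (Ne.symm h0)), mul_comm] at h1

/-! ### Sequences in a fixed chaos -/

section Sequences

variable {p : ℕ} {F : ℕ → L2}

/-- The fourth cumulant of an asymptotically Gaussian sequence tends to zero. -/
lemma tendsto_variance_of_tendstoInDistribution (hF : ∀ n, F n ∈ chaos p)
    (hnorm : Tendsto (fun n => ‖F n‖ ^ 2) atTop (𝓝 1))
    (h : TendstoInDistribution (fun n ω => F n ω) atTop (id : ℝ → ℝ)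
      (fun _ => gaussianProd) (gaussianReal 0 1)) :
    Tendsto (fun n => variance (gamL2 p p (F n) (F n)) gaussianProd) atTop (𝓝 0) := by
  have h3 : Tendsto (fun n => 3 * (‖F n‖ ^ 2) ^ 2) atTop (𝓝 (3 * 1 ^ 2)) :=
    (hnorm.pow 2).const_mul 3
  refine tendsto_order.2 ⟨fun a ha => Eventually.of_forall fun n =>
    ha.trans_le (variance_nonneg _ _), fun a ha => ?_⟩
  have hc : (0 : ℝ) < p ^ 2 / 3 + 1 := by positivity
  set ε : ℝ := a / (p ^ 2 / 3 + 1) / 2 with hε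
  have hε0 : 0 < ε := by positivity
  have hεa : (p ^ 2 / 3 + 1) * (2 * ε) = a := by rw [hε]; field_simp
  filter_upwards [eventually_norm_mulL2_lt (fun n => chaos_le_chaosLE le_rfl (hF n)) hnorm h hε0,
    h3.eventually_const_lt (by linarith : 3 * 1 ^ 2 - ε < (3 : ℝ) * 1 ^ 2)] with n h1 h2
  refine (variance_gamL2_le (hF n)).trans_lt ?_
  have h4 : (p : ℝ) ^ 2 / 3 * (‖mulL2 (F n) (F n)‖ ^ 2 - 3 * (‖F n‖ ^ 2) ^ 2) ≤
      p ^ 2 / 3 * (2 * ε) :=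
    mul_le_mul_of_nonneg_left (by linarith) (by positivity)
  linarith

lemma tendsto_norm_gamL2_sub (hF : ∀ n, F n ∈ chaos p)
    (hnorm : Tendsto (fun n => ‖F n‖ ^ 2) atTop (𝓝 1))
    (h : Tendsto (fun n => variance (gamL2 p p (F n) (F n)) gaussianProd) atTop (𝓝 0)) :
    Tendsto (fun n => ‖gamL2 p p (F n) (F n) - (p : ℝ) • oneL2‖) atTop (𝓝 0) := by
  have h1 : Tendsto (fun n => variance (gamL2 p p (F n) (F n)) gaussianProd +
      (p * (‖F n‖ ^ 2 - 1)) ^ 2) atTop (𝓝 (0 + ((p : ℝ) * (1 - 1)) ^ 2)) :=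
    h.add (((hnorm.sub_const 1).const_mul (p : ℝ)).pow 2)
  have h2 := h1.sqrt
  simp_rw [← fun n => norm_gamL2_sub_sq (hF n), Real.sqrt_sq (norm_nonneg _)] at h2
  simpa using h2

lemma tendsto_ouHermL2_zero (hF : ∀ n, F n ∈ chaos p)
    (hnorm : Tendsto (fun n => ‖F n‖ ^ 2) atTop (𝓝 1))
    (h : Tendsto (fun n => ‖gamL2 p p (F n) (F n) - (p : ℝ) • oneL2‖) atTop (𝓝 0))
    {k : ℕ} (hk : 2 ≤ k) : Tendsto (fun n => ouHermL2 p k (F n)) atTop (𝓝 0) := by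
  obtain ⟨C, -, hb⟩ := exists_norm_ouHermL2_sq_le p k hk
  rw [tendsto_zero_iff_norm_tendsto_zero]
  have h1 : Tendsto (fun n => √(C * ‖gamL2 p p (F n) (F n) - (p : ℝ) • oneL2‖ ^ 2)) atTop
      (𝓝 √(C * 0 ^ 2)) := ((h.pow 2).const_mul C).sqrt
  rw [zero_pow two_ne_zero, mul_zero, Real.sqrt_zero] at h1
  refine squeeze_zero' (Eventually.of_forall fun n => norm_nonneg _) ?_ h1
  filter_upwards [hnorm.eventually_lt_const (by norm_num : (1 : ℝ) < 2)] with n hn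
  exact Real.le_sqrt_of_sq_le (hb (F n) (hF n) hn)

/-- On the chaos of degree `q ≤ kp` the operator `L + kp` is multiplication by `kp - q`, and
`H_k(F n)` has no component of degree `q > kp`. -/
lemma tendsto_J_hermL2 (hF : ∀ n, F n ∈ chaos p) {k q : ℕ}
    (h : Tendsto (fun n => ouHermL2 p k (F n)) atTop (𝓝 0)) (hq : q ≠ k * p) :
    Tendsto (fun n => J q (hermL2 k (F n))) atTop (𝓝 0) := by
  rcases lt_or_gt_of_ne hq with hlt | hgt
  · have hne : (k : ℝ) * p - q ≠ 0 := by
      have : (q : ℝ) < k * p := by exact_mod_cast hlt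
      exact (sub_pos.2 this).ne'
    have h1 := (((J q).continuous.tendsto _).comp h).const_smul ((k : ℝ) * p - q)⁻¹
    rw [map_zero, smul_zero] at h1
    refine h1.congr fun n => ?_
    rw [Function.comp_apply, J_ouHermL2 hlt.le, inv_smul_smul₀ hne]
  · refine tendsto_const_nhds.congr fun n => ?_
    rw [J_eq_zero_of_lt hgt (hermL2_mem (chaos_le_chaosLE le_rfl (hF n)) k)]

lemma inner_oneL2_J_zero (X : L2) : inner ℝ oneL2 (J 0 X) = (inner ℝ oneL2 X : ℝ) := by
  rw [J, ← Submodule.inner_starProjection_left_eq_right,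
    Submodule.starProjection_eq_self_iff.2 oneL2_mem]

/-- The expectation of `H_k(F)` is its component in the chaos of degree `0`, and for `k = 1` it
vanishes, so the expectations of all Hermite polynomials converge to their Gaussian values. -/
lemma tendstoInDistribution_of_J_hermL2 (hp : 1 ≤ p) (hF : ∀ n, F n ∈ chaos p)
    (h : ∀ k, 2 ≤ k → Tendsto (fun n => J 0 (hermL2 k (F n))) atTop (𝓝 0)) :
    TendstoInDistribution (fun n ω => F n ω) atTop (id : ℝ → ℝ)
      (fun _ => gaussianProd) (gaussianReal 0 1) := by
  have hae : ∀ n k, hermL2 k (F n) =ᵐ[gaussianProd] hermiteOf k (F n) := fun n k =>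
    coeFn_hermL2 (chaos_le_chaosLE le_rfl (hF n)) k
  refine tendstoInDistribution_of_hermite
    (fun n k => ((Lp.memLp (hermL2 k (F n))).integrable one_le_two).congr (hae n k))
    fun k hk => ?_
  simp_rw [← fun n => integral_congr_ae (hae n k), ← inner_oneL2]
  rcases (by omega : k = 1 ∨ 2 ≤ k) with rfl | hk2
  · refine tendsto_const_nhds.congr fun n => ?_
    rw [hermL2_one, inner_eq_zero_of_mem_chaos (by omega) oneL2_mem (hF n)]
  · have := (tendsto_const_nhds (x := oneL2)).inner (𝕜 := ℝ) (h k hk2)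
    rw [inner_zero_right] at this
    exact this.congr fun n => inner_oneL2_J_zero _

lemma tendsto_influence (hF : ∀ n, F n ∈ chaos p)
    (h : Tendsto (fun n => ‖gamL2 p p (F n) (F n) - (p : ℝ) • oneL2‖) atTop (𝓝 0))
    {q : ℕ} (hq : q < p) : Tendsto (fun n => influence q (F n)) atTop (𝓝 0) := by
  obtain ⟨C, -, hb⟩ := exists_norm_gamL2_sq_le p q hq
  have h1 : Tendsto (fun n => ENNReal.ofReal
      √(C * ‖gamL2 p p (F n) (F n) - (p : ℝ) • oneL2‖)) atTop
      (𝓝 (ENNReal.ofReal √(C * 0))) := ENNReal.tendsto_ofReal (h.const_mul C).sqrt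
  rw [mul_zero, Real.sqrt_zero, ENNReal.ofReal_zero] at h1
  refine tendsto_of_tendsto_of_tendsto_of_le_of_le tendsto_const_nhds h1 (fun _ => bot_le)
    fun n => influence_le (hF n) fun X hX hX1 => Real.le_sqrt_of_sq_le ?_
  have := hb (F n) X (hF n) hX
  rwa [hX1, one_pow, mul_one] at this

lemma tendsto_variance_of_tendsto_influence (hp : 1 ≤ p) (hF : ∀ n, F n ∈ chaos p)
    (hnorm : Tendsto (fun n => ‖F n‖ ^ 2) atTop (𝓝 1)) {q : ℕ} (hq : p / 2 ≤ q)
    (h : Tendsto (fun n => influence q (F n)) atTop (𝓝 0)) :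
    Tendsto (fun n => variance (gamL2 p p (F n) (F n)) gaussianProd) atTop (𝓝 0) := by
  obtain ⟨C, -, hb⟩ := exists_variance_gamL2_le p q hp hq
  have hr : Tendsto (fun n => (influence q (F n)).toReal) atTop (𝓝 0) := by
    simpa [Function.comp_def] using (ENNReal.tendsto_toReal ENNReal.zero_ne_top).comp h
  have h1 := ((hr.pow 2).mul hnorm).const_mul C
  rw [zero_pow two_ne_zero, zero_mul, mul_zero] at h1
  refine squeeze_zero' (Eventually.of_forall fun n => variance_nonneg _ _) ?_ h1
  filter_upwards [h.eventually_lt_const ENNReal.zero_lt_top] with n hn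
  exact hb (F n) _ (hF n) ENNReal.toReal_nonneg fun X hX =>
    norm_gamL2_le_influence (hF n) hn.ne hX

lemma L_toL2_hermiteOf {F : L2} (hF : F ∈ chaos p) (k : ℕ) :
    L (toL2 (hermiteOf k F)) + ((k : ℝ) * (p : ℝ)) • toL2 (hermiteOf k F) = ouHermL2 p k F := by
  have h := hermL2_mem (chaos_le_chaosLE le_rfl hF) k
  rw [ouHermL2, ← L_eq_genLE h, hermL2]

end Sequences

end Wiener

end

theorem mainTheorem3 (p : ℕ) (hp : 1 ≤ p) (F : ℕ → Wiener.L2)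
    (hF : ∀ n, F n ∈ Wiener.chaos p)
    (hvar : Tendsto (fun n => ∫ ω, (F n ω) ^ 2 ∂Wiener.gaussianProd) atTop (𝓝 1)) :
    -- the products and Hermite polynomials to which `L`, `J` are applied lie in finite chaoses
    (∀ n q, ∀ X ∈ Wiener.chaos q, ∃ Y ∈ Wiener.chaosLE (p + q),
      Y =ᵐ[Wiener.gaussianProd] fun ω => F n ω * X ω) ∧
    (∀ n k, ∃ Y ∈ Wiener.chaosLE (k * p),
      Y =ᵐ[Wiener.gaussianProd] Wiener.hermiteOf k (F n)) ∧
    List.TFAE [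
      TendstoInDistribution (fun n ω => F n ω) atTop (id : ℝ → ℝ)
        (fun _ => Wiener.gaussianProd) (gaussianReal 0 1),
      Tendsto (fun n => variance (Wiener.Gam (F n) (F n)) Wiener.gaussianProd) atTop (𝓝 0),
      ∀ k : ℕ, 2 ≤ k → Tendsto (fun n =>
        Wiener.L (Wiener.toL2 (Wiener.hermiteOf k (F n)))
          + ((k : ℝ) * (p : ℝ)) • Wiener.toL2 (Wiener.hermiteOf k (F n))) atTop (𝓝 0),
      ∀ k : ℕ, 2 ≤ k → ∀ q : ℕ, q ≠ k * p →
        Tendsto (fun n => Wiener.J q (Wiener.toL2 (Wiener.hermiteOf k (F n)))) atTop (𝓝 0),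
      Tendsto (fun n => Wiener.influence (p - 1) (F n)) atTop (𝓝 0),
      Tendsto (fun n => Wiener.influence (p / 2) (F n)) atTop (𝓝 0)] := by
  have hF' : ∀ n, F n ∈ Wiener.chaosLE p := fun n => Wiener.chaos_le_chaosLE le_rfl (hF n)
  refine ⟨fun n q X hX => ⟨Wiener.mulL2 (F n) X,
      Wiener.mulL2_mem_chaosLE (hF' n) (Wiener.chaos_le_chaosLE le_rfl hX),
      Wiener.coeFn_mulL2 (hF' n) (Wiener.chaos_le_chaosLE le_rfl hX)⟩,
    fun n k => ⟨Wiener.hermL2 k (F n), Wiener.hermL2_mem (hF' n) k,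
      Wiener.coeFn_hermL2 (hF' n) k⟩, ?_⟩
  have hnorm : Tendsto (fun n => ‖F n‖ ^ 2) atTop (𝓝 1) :=
    hvar.congr fun n => (Wiener.norm_sq_eq_integral (F n)).symm
  have hdev := Wiener.tendsto_norm_gamL2_sub hF hnorm
  simp_rw [fun n => Wiener.variance_Gam (hF n) (hF n), fun n k => Wiener.L_toL2_hermiteOf (hF n) k]
  tfae_have 1 → 2 := Wiener.tendsto_variance_of_tendstoInDistribution hF hnorm
  tfae_have 2 → 3 := fun h k hk => Wiener.tendsto_ouHermL2_zero hF hnorm (hdev h) hk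
  tfae_have 3 → 4 := fun h k hk q hq => Wiener.tendsto_J_hermL2 hF (h k hk) hq
  tfae_have 4 → 1 := fun h => Wiener.tendstoInDistribution_of_J_hermL2 hp hF fun k hk =>
    h k hk 0 (Nat.mul_pos (by omega) hp).ne
  tfae_have 2 → 5 := fun h => Wiener.tendsto_influence hF (hdev h) (by omega)
  tfae_have 2 → 6 := fun h => Wiener.tendsto_influence hF (hdev h) (by omega)
  tfae_have 5 → 2 :=
    Wiener.tendsto_variance_of_tendsto_influence hp hF hnorm (by omega : p / 2 ≤ p - 1)
  tfae_have 6 → 2 := Wiener.tendsto_variance_of_tendsto_influence hp hF hnorm le_rfl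
  tfae_finish
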